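/- Let $0\le n<m$ be integers and let $\lambda$ be a partition of length $\ell(\lambda)\le n$. Put $\delta=(n,n-1,\ldots,1)$ and $\mu=\lambda+\delta$, i.e. $\mu_j=\lambda_j+n-j+1$ for $1\le j\le n$, and assume that all parts of $\mu$ are at most $m$ (i.e. $\mu_1\le m$). An $m\times m$ alternating sign matrix (ASM) is an $m\times m$ matrix with entries in $\{-1,0,1\}$ such that every row and every column is nonzero, its first and last nonzero entries are $1$, and its nonzero entries alternate in sign. An $n\times m$ matrix $A=(a_{iq})$ is a $\mu$-ASM if (1) $a_{iq}\in\{-1,0,1\}$ for all $i,q$; (2) $\sum_{q=p}^m a_{iq}\in\{0,1\}$ for $1\le i\le n$, $1\le p\le m$; (3) $\sum_{i=1}^{j} a_{iq}\in\{0,1\}$ for $1\le j\le n$, $1\le q\le m$; (4) $\sum_{q=1}^m a_{iq}=1$ for $1\le i\le n$; (5) $\sum_{i=1}^n a_{iq}$ equals $1$ if $q=\mu_j$ for some $j$, and $0$ otherwise, for $1\le q\le m$. Let $\mathcal A(n,m,\mu)$ be the set of $m\times m$ ASMs $C$ whose top $n$ rows form a $\mu$-ASM. The compass points matrix of an $m\times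 m$ ASM $C$ is obtained by replacing each entry $1$ by $WE$, each entry $-1$ by $NS$, and each entry $0$ by one of $NE,SE,NW,SW$: the second letter is $E$ if the nearest nonzero entry to its right in its row exists and is $1$, and $W$ otherwise; the first letter is $N$ if the nearest nonzero entry below it in its column exists and is $1$, and $S$ otherwise. Let $NE_k(C)$, $SE_k(C)$, $NS_k(C)$ be the numbers of entries $NE$, $SE$, $NS$ in the $k$th row of this matrix. For a partition $\rho$, let $s_\rho(z_1,\ldots,z_N)=\sum_T\prod_{b\in\rho} z_{T(b)}$ be the Schur function, where the sum is over the semistandard tableaux $T$ of shape $\rho$ with entries in $\{1,\ldots,N\}$ and the product is over the boxes $b$ of $\rho$. Let $\kappa=((m-n)^n/\lambda)'$ be the conjugate of the complement of $\lambda$ in the rectangle with $n$ rows of length $m-n$; that is, $\kappa_j=n-\lambda'_{m-n-j+1}$ for $1\le j\le m-n$. Then for all elements $x_1,\ldots,x_m$ and $y_1,\ldots,y_m$ of a commutative ring, $$\prod_{1\le i<j\le n}(x_i+y_j)\; s_\lambda(x_1,\ldots,x_n)\prod_{n+1\le i<j\le m}(x_i+y_j)\; s_\kappa(y_{n+1},\ldots,y_m)=\sum_{C\in\mathcal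 A(n,m,\mu)}\ \prod_{k=1}^m x_k^{NE_k(C)}\,y_k^{SE_k(C)}\,(x_k+y_k)^{NS_k(C)}.$$ -/

import Mathlib

/-- A finite integer sequence with entries in `{-1, 0, 1}`, not identically zero, whose first and
last nonzero entries are `1` and whose nonzero entries alternate in sign. -/
structure IsAlternatingSignSeq {m : ℕ} (v : Fin m → ℤ) : Prop where
  entries : ∀ i, v i = -1 ∨ v i = 0 ∨ v i = 1
  exists_ne_zero : ∃ i, v i ≠ 0
  first : ∀ i, v i ≠ 0 → (∀ j, j < i → v j = 0) → v i = 1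
  last : ∀ i, v i ≠ 0 → (∀ j, i < j → v j = 0) → v i = 1
  alternate : ∀ i j, i < j → v i ≠ 0 → v j ≠ 0 → (∀ k, i < k → k < j → v k = 0) → v j = - v i

/-- An `m × m` alternating sign matrix. -/
structure IsASM {m : ℕ} (C : Matrix (Fin m) (Fin m) ℤ) : Prop where
  row : ∀ i, IsAlternatingSignSeq (fun q => C i q)
  col : ∀ q, IsAlternatingSignSeq (fun i => C i q)

/-- An `n × m` `μ`-alternating sign matrix, where `μ` has the parts `μ 0, …, μ (n - 1)`.
The column with index `q : Fin m` carries the label `q + 1`. -/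
structure IsMuASM {n m : ℕ} (μ : Fin n → ℕ) (A : Matrix (Fin n) (Fin m) ℤ) : Prop where
  entries : ∀ i q, A i q = -1 ∨ A i q = 0 ∨ A i q = 1
  row_partial : ∀ i p, (∑ q ∈ Finset.Ici p, A i q) = 0 ∨ (∑ q ∈ Finset.Ici p, A i q) = 1
  col_partial : ∀ j q, (∑ i ∈ Finset.Iic j, A i q) = 0 ∨ (∑ i ∈ Finset.Iic j, A i q) = 1
  row_sum : ∀ i, ∑ q, A i q = 1
  col_sum_mem : ∀ q : Fin m, (∃ j, μ j = (q : ℕ) + 1) → ∑ i, A i q = 1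
  col_sum_not_mem : ∀ q : Fin m, (¬ ∃ j, μ j = (q : ℕ) + 1) → ∑ i, A i q = 0

/-- The parts of `λ + δ` with `δ = (n, n - 1, …, 1)`, for a partition `λ` of length at most `n`
(rows are counted from `0`). -/
def addDelta (n : ℕ) (lam : YoungDiagram) (j : Fin n) : ℕ :=
  lam.rowLen j + (n - (j : ℕ))

/-- The set of `m × m` alternating sign matrices whose top `n` rows form a `μ`-alternating sign
matrix. -/
def asmWithTop {n m : ℕ} (h : n ≤ m) (μ : Fin n → ℕ) : Set (Matrix (Fin m) (Fin m) ℤ) :=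
  {C | IsASM C ∧ IsMuASM μ (C.submatrix (Fin.castLE h) id)}

theorem asmWithTop_finite {n m : ℕ} (h : n ≤ m) (μ : Fin n → ℕ) : (asmWithTop h μ).Finite := by
  have hf : ({C | ∀ i q, C i q ∈ ({-1, 0, 1} : Set ℤ)} : Set (Fin m → Fin m → ℤ)).Finite := by
    have := Set.Finite.pi' (fun _ : Fin m => Set.Finite.pi' (fun _ : Fin m =>
      Set.toFinite ({-1, 0, 1} : Set ℤ)))
    exact this
  refine hf.subset ?_
  intro C hC i q
  simpa using (hC.1.row i).entries q

/-- The six vertex configurations of square ice, named by the directions of the incoming edges. -/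
inductive CompassPoint : Type
  | WE | NS | NE | SW | NW | SE

/-- The nearest nonzero entry of row `k` to the right of column `q` exists and is `1`. -/
def NearestRightIsOne {m : ℕ} (C : Matrix (Fin m) (Fin m) ℤ) (k q : Fin m) : Prop :=
  ∃ r, q < r ∧ C k r = 1 ∧ ∀ s, q < s → s < r → C k s = 0

/-- The nearest nonzero entry of column `q` below row `k` exists and is `1`. -/
def NearestBelowIsOne {m : ℕ} (C : Matrix (Fin m) (Fin m) ℤ) (k q : Fin m) : Prop :=
  ∃ r, k < r ∧ C r q = 1 ∧ ∀ s, k < s → s < r → C s q = 0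

open Classical in
/-- The compass points matrix of an alternating sign matrix. An entry `1` is `WE` and an entry `-1`
is `NS`. A zero is an east (west) zero if its nearest nonzero neighbour to the right is `1`
(is `-1` or absent), and a north (south) zero if its nearest nonzero neighbour below is `1`
(is `-1` or absent). -/
noncomputable def compassMatrix {m : ℕ} (C : Matrix (Fin m) (Fin m) ℤ) :
    Matrix (Fin m) (Fin m) CompassPoint := fun k q =>
  if C k q = 1 then .WE
  else if C k q = -1 then .NS
  else if NearestRightIsOne C k q then
    if NearestBelowIsOne C k q then .NE else .SE
  else
    if NearestBelowIsOne C k q then .NW else .SW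

open Classical in
/-- The number of entries equal to `c` in row `k` of the compass points matrix of `C`. -/
noncomputable def compassCount {m : ℕ} (c : CompassPoint) (C : Matrix (Fin m) (Fin m) ℤ)
    (k : Fin m) : ℕ :=
  (Finset.univ.filter (fun q => compassMatrix C k q = c)).card

/-- The semistandard tableaux of shape `λ` with entries among the first `N` letters
`0, …, N - 1`. -/
def boundedSSYT (N : ℕ) (lam : YoungDiagram) : Set (SemistandardYoungTableau lam) :=
  {T | ∀ i j, (i, j) ∈ lam → T i j < N}

theorem boundedSSYT_finite (N : ℕ) (lam : YoungDiagram) : (boundedSSYT N lam).Finite := by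
  let f : boundedSSYT N lam → (lam.cells → Fin N) := fun T c =>
    ⟨T.1 c.1.1 c.1.2, T.2 _ _ c.2⟩
  have hf : Function.Injective f := by
    intro S T h
    apply Subtype.ext
    ext i j
    by_cases hc : (i, j) ∈ lam
    · exact congrArg Fin.val (congrFun h ⟨(i, j), hc⟩)
    · rw [S.1.zeros hc, T.1.zeros hc]
  exact Finite.of_injective f hf

/-- The Schur function `s_λ` in `N` variables, evaluated at `x 0, …, x (N - 1)`: the sum of the
monomial weights of the semistandard tableaux of shape `λ` with entries among `N` letters. -/
noncomputable def schurValue {R : Type*} [CommRing R] (N : ℕ) (lam : YoungDiagram) (x : ℕ → R) :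
    R :=
  ∑ T ∈ (boundedSSYT_finite N lam).toFinset, ∏ c ∈ lam.cells, x (T c.1 c.2)

/-- The complement of `λ` in the rectangle with `a` rows of length `b`: the cells of the rectangle
outside `λ`, rotated by 180 degrees. -/
def rectComplement (a b : ℕ) (lam : YoungDiagram) : YoungDiagram where
  cells := (Finset.range a ×ˢ Finset.range b).filter
    (fun c => (a - 1 - c.1, b - 1 - c.2) ∉ lam)
  isLowerSet := by
    rintro ⟨i, j⟩ ⟨i', j'⟩ h hc
    obtain ⟨h1, h2⟩ := Prod.mk_le_mk.mp h
    simp only [Finset.coe_filter, Finset.mem_product, Finset.mem_range, Set.mem_ofPred_eq] at hc ⊢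
    refine ⟨⟨by omega, by omega⟩, fun hmem => hc.2 ?_⟩
    exact lam.up_left_mem (by omega) (by omega) hmem

/-! An alternating sign matrix is encoded by its column states: the sets `P_k` of columns whose
first `k` entries sum to 1. These form a chain from the empty set to the set of all columns, in
which consecutive sets interlace. The numbers of NE, SE and NS entries in a row depend only on the
two states around that row, so the right-hand side is a sum over paths with a weight for each step.
The condition on the top `n` rows only fixes the state `P_n`. Hence the sum factors into a partition
function of the top `n` rows and one of the bottom `m - n` rows.

The top factor is computed by induction on rows (`topWeight_mul_staircaseAlternant`): multiplied by
the Vandermonde determinant, it is `∏ (x_i + y_j)` times the alternant whose exponents are the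
elements of the state. In the inductive step the weight of a row splits over the gaps between
consecutive elements of the upper state `t`. By multilinearity of the determinant, the sum over
interlacing states becomes one determinant. Its column `j` contains the factor `x_j + y`, and what
remains is `gapMatrix`. The same matrix appears when the alternant of `t` is row-reduced
(`alternant_succ`), which closes the induction. It also governs the branching rule of tableaux,
which gives the bialternant formula; dividing by the Vandermonde determinant then yields the product
times the Schur function.

The bottom factor is a top factor in disguise: reading the rows upwards, complementing every state
and exchanging `x` with `y` preserves row weights (`rowWeight_compl`). The complementary state
belongs to the conjugate of the rectangular complement of `λ` (`shiftedRowSet_compl`). The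
Vandermonde determinant is cancelled in the universal polynomial ring over `ℤ`, and the identity is
then specialized to any commutative ring. -/

/-! ### Alternants and gap determinants -/

/-- The alternant `det (x_j ^ t_i)` in the variables `x 0, …, x (n - 1)`. -/
def alternant {R : Type*} [CommRing R] (x : ℕ → R) {n : ℕ} (t : Fin n → ℕ) : R :=
  (Matrix.of fun i j : Fin n => x j ^ t i).det

theorem alternant_eq_zero_of_not_injective {R : Type*} [CommRing R] (x : ℕ → R) {n : ℕ}
    {t : Fin n → ℕ} (h : ¬ Function.Injective t) : alternant x t = 0 := by
  simp only [Function.Injective, not_forall] at h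
  obtain ⟨i, j, hij, hne⟩ := h
  exact Matrix.det_zero_of_row_eq hne (by ext k; simp [hij])

/-- Multilinearity in the rows: an independent choice of exponent in each row sums to a single
determinant. Repeated exponents contribute zero, so the sum need not be restricted to strict
sequences. -/
theorem sum_piFinset_prod_mul_alternant {R : Type*} [CommRing R] (x : ℕ → R) {n : ℕ}
    (A : Fin n → Finset ℕ) (f : Fin n → ℕ → R) :
    ∑ s ∈ Fintype.piFinset A, (∏ i, f i (s i)) * alternant x s
      = (Matrix.of fun i j : Fin n => ∑ k ∈ A i, f i k * x j ^ k).det := by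
  have h := (Matrix.detRowAlternating (n := Fin n) (R := R)).toMultilinearMap.map_sum_finset
    (fun i k => f i k • fun j : Fin n => x j ^ k) A
  have e : (fun i => ∑ k ∈ A i, (f i k • fun j : Fin n => x j ^ k))
      = Matrix.of fun i j : Fin n => ∑ k ∈ A i, f i k * x j ^ k := by
    ext i j; simp [Finset.sum_apply]
  rw [e] at h
  refine Eq.trans ?_ h.symm
  refine Finset.sum_congr rfl fun s _ => ?_
  rw [MultilinearMap.map_smul_univ]
  rfl

/-- The matrix of the complete homogeneous sums over the gaps of an exponent sequence. -/
def gapMatrix {R : Type*} [CommRing R] (x : ℕ → R) {n : ℕ} (t : Fin (n + 1) → ℕ) :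
    Matrix (Fin n) (Fin n) R :=
  Matrix.of fun i j => ∑ k ∈ Finset.Ico (t i.castSucc) (t i.succ),
    x n ^ (t i.succ - 1 - k) * x j ^ k

/-- Subtracting from each row the multiple of its predecessor that kills the entry in `x n` leaves
only the top entry in the last column. The other entries become differences divisible by `x j - x
n`, with the entries of `gapMatrix` as quotients. -/
theorem alternant_succ {R : Type*} [CommRing R] (x : ℕ → R) {n : ℕ} {t : Fin (n + 1) → ℕ}
    (ht : Monotone t) :
    alternant x t = x n ^ t 0 * (∏ j ∈ Finset.range n, (x n - x j)) * (gapMatrix x t).det := by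
  have hle : ∀ i : Fin n, t i.castSucc ≤ t i.succ := fun i => ht (Fin.castSucc_le_succ i)
  have hpow : ∀ i : Fin n, x n ^ (t i.succ - t i.castSucc) * x n ^ t i.castSucc
      = x n ^ t i.succ := fun i => by rw [← pow_add, Nat.sub_add_cancel (hle i)]
  let B : Matrix (Fin (n + 1)) (Fin (n + 1)) R := Matrix.of <| Fin.cons (fun j => x j ^ t 0)
    fun i j => x j ^ t i.succ - x n ^ (t i.succ - t i.castSucc) * x j ^ t i.castSucc
  have h1 : alternant x t = B.det := by
    refine Matrix.det_eq_of_forall_row_eq_smul_add_pred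
      (fun i => x n ^ (t i.succ - t i.castSucc)) (fun j => by simp [B]) fun i j => ?_
    simp [B]
  have h2 : B.det = (-1) ^ n * x n ^ t 0
      * (Matrix.of fun i j : Fin n =>
        x j ^ t i.succ - x n ^ (t i.succ - t i.castSucc) * x j ^ t i.castSucc).det := by
    rw [Matrix.det_succ_column B (Fin.last n), Fin.sum_univ_succ, Finset.sum_eq_zero, add_zero]
    · congr 1
      · simp [B]
      · congr 1
        ext i j
        simp [B]
    · intro i _
      have : B i.succ (Fin.last n) = 0 := by simp [B, hpow]
      rw [this]; ring
  have h3 : (Matrix.of fun i j : Fin n =>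
        x j ^ t i.succ - x n ^ (t i.succ - t i.castSucc) * x j ^ t i.castSucc)
      = Matrix.of fun i j : Fin n => (x j - x n) * gapMatrix x t i j := by
    ext i j
    simp only [Matrix.of_apply, gapMatrix]
    have := mul_geom_sum₂_Ico (x j) (x n) (hle i)
    simp only [mul_comm (x n ^ _)]
    rw [this]
  rw [h1, h2, h3, Matrix.det_mul_row, Finset.prod_range]
  -- This sign cancels the one from expanding along the last column.
  have : ∏ j : Fin n, (x j - x n) = (-1) ^ n * ∏ j : Fin n, (x n - x j) := by
    have h := Finset.prod_neg (s := Finset.univ) (fun j : Fin n => x n - x j)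
    simpa using h
  rw [this]
  have e : ((-1 : R) ^ n) * (-1) ^ n = 1 := by rw [← mul_pow]; simp
  linear_combination (x n ^ t 0 * (∏ j : Fin n, (x n - x j)) * (gapMatrix x t).det) * e

theorem sum_schur_branching_alternant {R : Type*} [CommRing R] (x : ℕ → R) {n : ℕ}
    (t : Fin (n + 1) → ℕ) :
    ∑ s ∈ Fintype.piFinset fun i : Fin n => Finset.Ico (t i.castSucc) (t i.succ),
      (∏ i : Fin n, x n ^ (t i.succ - 1 - s i)) * alternant x s = (gapMatrix x t).det := by
  rw [sum_piFinset_prod_mul_alternant x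
    (fun i : Fin n => Finset.Ico (t i.castSucc) (t i.succ))
    (fun i k => x n ^ (t i.succ - 1 - k))]
  rfl

/-- The weight of an entry `k` of a strict Gelfand–Tsetlin pattern below its neighbours `a < b`. -/
def gapWeight {R : Type*} [CommRing R] (x y : R) (a b k : ℕ) : R :=
  (if a < k then x ^ (b - k) else 0) + if k < b then y * x ^ (b - 1 - k) else 0

/-- The first summand of the weight, reindexed by one, gives `z` times the homogeneous sum, and the
second gives `y` times the same sum. This is where the factor `x_i + y_j` of the theorem originates.
-/
theorem sum_gapWeight_mul_pow {R : Type*} [CommRing R] (x y z : R) (a b : ℕ) :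
    ∑ k ∈ Finset.Icc a b, gapWeight x y a b k * z ^ k
      = (z + y) * ∑ k ∈ Finset.Ico a b, x ^ (b - 1 - k) * z ^ k := by
  simp only [gapWeight, add_mul, Finset.sum_add_distrib, ite_mul, zero_mul]
  congr 1
  · rw [← Finset.sum_filter, Finset.mul_sum]
    symm
    refine Finset.sum_bij (fun k _ => k + 1) ?_ ?_ ?_ ?_
    · intro k hk; simp at hk ⊢; omega
    · intro a _ b _ h; simpa using h
    · intro k hk
      simp at hk
      exact ⟨k - 1, by simp; omega, by omega⟩
    · intro k hk
      simp at hk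
      rw [show b - (k + 1) = b - 1 - k by omega]
      ring
  · rw [← Finset.sum_filter, Finset.mul_sum]
    refine Finset.sum_congr ?_ fun k _ => by ring
    ext k; simp; omega

theorem sum_gapWeight_alternant {R : Type*} [CommRing R] (x : ℕ → R) (y : R) {n : ℕ}
    (t : Fin (n + 1) → ℕ) :
    ∑ s ∈ Fintype.piFinset fun i : Fin n => Finset.Icc (t i.castSucc) (t i.succ),
      (∏ i : Fin n, gapWeight (x n) y (t i.castSucc) (t i.succ) (s i)) * alternant x s
      = (∏ j ∈ Finset.range n, (x j + y)) * (gapMatrix x t).det := by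
  rw [sum_piFinset_prod_mul_alternant x
    (fun i : Fin n => Finset.Icc (t i.castSucc) (t i.succ))
    (fun i k => gapWeight (x n) y (t i.castSucc) (t i.succ) k), Finset.prod_range,
    ← Matrix.det_mul_row]
  congr 1
  ext i j
  simp only [Matrix.of_apply]
  rw [sum_gapWeight_mul_pow]
  rfl

/-- The Vandermonde determinant of `x 0, …, x (n - 1)`. -/
def staircaseAlternant {R : Type*} [CommRing R] (x : ℕ → R) (n : ℕ) : R :=
  alternant x fun i : Fin n => (i : ℕ)

/-- All gaps equal 1, so each homogeneous sum has one term and the gap matrix is the smaller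
Vandermonde matrix. -/
theorem staircaseAlternant_succ {R : Type*} [CommRing R] (x : ℕ → R) (n : ℕ) :
    staircaseAlternant x (n + 1)
      = (∏ j ∈ Finset.range n, (x n - x j)) * staircaseAlternant x n := by
  rw [staircaseAlternant, alternant_succ x Fin.val_strictMono.monotone]
  have : gapMatrix x (fun i : Fin (n + 1) => (i : ℕ))
      = Matrix.of fun i j : Fin n => x j ^ (i : ℕ) := by
    ext i j
    simp [gapMatrix]
  rw [this]
  simp [staircaseAlternant, alternant]

theorem staircaseAlternant_ne_zero {R : Type*} [CommRing R] [IsDomain R] {x : ℕ → R} {n : ℕ}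
    (hx : Set.InjOn x (Set.Iio n)) : staircaseAlternant x n ≠ 0 := by
  induction n with
  | zero => simp [staircaseAlternant, alternant]
  | succ n ih =>
    rw [staircaseAlternant_succ]
    refine mul_ne_zero (Finset.prod_ne_zero_iff.mpr fun j hj => ?_)
      (ih (hx.mono (Set.Iio_subset_Iio (Nat.le_succ n))))
    rw [Finset.mem_range] at hj
    rw [sub_ne_zero]
    intro h
    have := hx (Set.mem_Iio.mpr (Nat.lt_succ_self n))
      (Set.mem_Iio.mpr (hj.trans (Nat.lt_succ_self n))) h
    omega

theorem alternant_reverse {R : Type*} [CommRing R] (x : ℕ → R) {n : ℕ} (t : Fin n → ℕ) :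
    alternant (fun i => x (n - 1 - i)) t
      = (Equiv.Perm.sign (Fin.revPerm (n := n)) : ℤ) * alternant x t := by
  rw [alternant, alternant, ← Matrix.det_permute']
  congr 1
  ext i j
  simp only [Matrix.of_apply, Matrix.submatrix_apply, id, Fin.revPerm_apply, Fin.val_rev]
  congr 2
  omega

/-! ### Diagrams as strictly increasing sequences -/

theorem YoungDiagram.fst_lt_of_colLen_le {lam : YoungDiagram} {n : ℕ}
    (h : lam.colLen 0 ≤ n) {i j : ℕ} (hc : (i, j) ∈ lam) : i < n :=
  lt_of_lt_of_le (YoungDiagram.mem_iff_lt_colLen.mp (lam.up_left_mem le_rfl (Nat.zero_le j) hc)) h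

theorem YoungDiagram.colLen_le_of_forall {lam : YoungDiagram} {n : ℕ}
    (h : ∀ i j, (i, j) ∈ lam → i < n) : lam.colLen 0 ≤ n := by
  by_contra! hlt
  exact lt_irrefl _ (h n 0 (YoungDiagram.mem_iff_lt_colLen.mpr hlt))

theorem YoungDiagram.card_eq_sum_rowLen {lam : YoungDiagram} {n : ℕ} (h : lam.colLen 0 ≤ n) :
    lam.card = ∑ i ∈ Finset.range n, lam.rowLen i := by
  rw [YoungDiagram.card, Finset.card_eq_sum_card_fiberwise (f := Prod.fst) (t := Finset.range n)]
  · exact Finset.sum_congr rfl fun i _ => (lam.rowLen_eq_card).symm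
  · rintro ⟨i, j⟩ hc
    simpa using YoungDiagram.fst_lt_of_colLen_le h (by simpa using hc)

/-- The strictly increasing sequence `λ_{n-1-i} + i` attached to a diagram with at most `n` rows. -/
def shiftedRows (n : ℕ) (lam : YoungDiagram) (i : Fin n) : ℕ :=
  lam.rowLen (n - 1 - i) + i

theorem shiftedRows_strictMono (n : ℕ) (lam : YoungDiagram) : StrictMono (shiftedRows n lam) := by
  intro i j hij
  have := lam.rowLen_anti (n - 1 - j) (n - 1 - i) (by omega)
  simp only [shiftedRows]
  omega

/-- The diagram whose shifted rows are a given strictly increasing sequence. -/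
def ofShiftedRows {n : ℕ} (s : Fin n → ℕ) : YoungDiagram where
  cells := (Finset.range n ×ˢ Finset.range (∑ i, s i)).filter
    -- For strictly increasing `s` only the smallest admissible `i` matters. Requiring all of them
    -- makes the set lower for arbitrary `s`; the bound by the sum only serves finiteness.
    fun c => ∀ i : Fin n, n ≤ i + 1 + c.1 → c.2 + i < s i
  isLowerSet := by
    rintro ⟨i, j⟩ ⟨i', j'⟩ h hc
    obtain ⟨h1, h2⟩ := Prod.mk_le_mk.mp h
    simp only [Finset.coe_filter, Finset.mem_product, Finset.mem_range, Set.mem_ofPred_eq] at hc ⊢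
    refine ⟨⟨by omega, by omega⟩, fun k hk => ?_⟩
    have := hc.2 k (by omega)
    omega

theorem mem_ofShiftedRows {n : ℕ} {s : Fin n → ℕ} {i j : ℕ} :
    (i, j) ∈ ofShiftedRows s ↔ i < n ∧ ∀ k : Fin n, n ≤ k + 1 + i → j + k < s k := by
  rw [← YoungDiagram.mem_cells]
  simp only [ofShiftedRows, Finset.mem_filter, Finset.mem_product, Finset.mem_range]
  refine ⟨fun h => ⟨h.1.1, h.2⟩, fun h => ⟨⟨h.1, ?_⟩, h.2⟩⟩
  have h1 := h.2 ⟨n - 1 - i, by omega⟩ (by simp; omega)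
  have h2 := Finset.single_le_sum (f := s) (fun i _ => Nat.zero_le _)
    (Finset.mem_univ (⟨n - 1 - i, by omega⟩ : Fin n))
  omega

theorem shiftedRows_ofShiftedRows {n : ℕ} {s : Fin n → ℕ} (hs : StrictMono s) :
    shiftedRows n (ofShiftedRows s) = s := by
  -- Strict increase means that `s i - i` is weakly increasing and nonnegative, so these differences
  -- are row lengths.
  have hmono : ∀ i k : Fin n, i ≤ k → s i + (k - i : ℕ) ≤ s k := by
    intro i k hik
    obtain ⟨k, hk⟩ := k
    induction k with
    | zero =>
      have : i = ⟨0, hk⟩ := le_antisymm hik (Fin.mk_le_of_le_val (Nat.zero_le _))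
      subst this; simp
    | succ k ih =>
      rcases eq_or_lt_of_le hik with rfl | hlt
      · simp
      · have hlt' : (i : ℕ) < k + 1 := hlt
        have h1 := ih (by omega) (Fin.mk_le_mk.mpr (by omega : (i : ℕ) ≤ k))
        have h2 : s ⟨k, by omega⟩ < s ⟨k + 1, hk⟩ := hs (Fin.mk_lt_mk.mpr (by omega))
        simp only at h1 ⊢
        omega
  ext i
  have hi : (i : ℕ) ≤ s i := by
    have := hmono ⟨0, i.pos⟩ i (Fin.mk_le_of_le_val (Nat.zero_le _))
    simp only at this
    omega
  have key : ∀ j, j < (ofShiftedRows s).rowLen (n - 1 - i) ↔ j < s i - i := by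
    intro j
    rw [← YoungDiagram.mem_iff_lt_rowLen, mem_ofShiftedRows]
    constructor
    · intro h
      have := h.2 i (by omega)
      omega
    · intro h
      refine ⟨by omega, fun k hk => ?_⟩
      have := hmono i k (Fin.mk_le_of_le_val (by omega))
      omega
  have h1 := key (s i - i)
  have h2 := key ((ofShiftedRows s).rowLen (n - 1 - i))
  simp only [shiftedRows]
  omega

theorem ofShiftedRows_shiftedRows {n : ℕ} {lam : YoungDiagram} (h : lam.colLen 0 ≤ n) :
    ofShiftedRows (shiftedRows n lam) = lam := by
  ext ⟨i, j⟩
  rw [YoungDiagram.mem_cells, YoungDiagram.mem_cells, mem_ofShiftedRows]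
  constructor
  · rintro ⟨hi, hk⟩
    have := hk ⟨n - 1 - i, by omega⟩ (by simp; omega)
    rw [YoungDiagram.mem_iff_lt_rowLen]
    simp only [shiftedRows] at this
    rw [show n - 1 - (n - 1 - i) = i by omega] at this
    omega
  · intro hc
    have hi := YoungDiagram.fst_lt_of_colLen_le h hc
    refine ⟨hi, fun k hk => ?_⟩
    have h1 := YoungDiagram.mem_iff_lt_rowLen.mp hc
    have h2 := lam.rowLen_anti (n - 1 - k) i (by omega)
    simp only [shiftedRows]
    omega

/-! ### Branching of tableaux and the bialternant formula -/

/-- The cells of a tableau with entries less than `N`. -/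
def SemistandardYoungTableau.subDiagram {lam : YoungDiagram} (T : SemistandardYoungTableau lam)
    (N : ℕ) : YoungDiagram where
  cells := lam.cells.filter fun c => T c.1 c.2 < N
  isLowerSet := by
    rintro ⟨i, j⟩ ⟨i', j'⟩ h hc
    obtain ⟨h1, h2⟩ := Prod.mk_le_mk.mp h
    simp only [Finset.coe_filter, YoungDiagram.mem_cells, Set.mem_ofPred_eq] at hc ⊢
    refine ⟨lam.up_left_mem h1 h2 hc.1, lt_of_le_of_lt ?_ hc.2⟩
    exact (T.col_weak h1 (lam.up_left_mem le_rfl h2 hc.1)).trans (T.row_weak_of_le h2 hc.1)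

theorem SemistandardYoungTableau.mem_subDiagram {lam : YoungDiagram}
    {T : SemistandardYoungTableau lam} {N i j : ℕ} :
    (i, j) ∈ T.subDiagram N ↔ (i, j) ∈ lam ∧ T i j < N := by
  rw [← YoungDiagram.mem_cells]
  simp [SemistandardYoungTableau.subDiagram]

theorem SemistandardYoungTableau.row_index_le {lam : YoungDiagram}
    (T : SemistandardYoungTableau lam) {i j : ℕ} (h : (i, j) ∈ lam) : i ≤ T i j := by
  induction i with
  | zero => exact Nat.zero_le _
  | succ i ih =>
    have h1 := ih (lam.up_left_mem (Nat.le_succ i) le_rfl h)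
    have h2 := T.col_strict (show i < i + 1 by omega) h
    omega

/-- The restriction of a tableau to a smaller diagram. -/
def SemistandardYoungTableau.restrict {lam nu : YoungDiagram} (T : SemistandardYoungTableau lam)
    (h : nu ≤ lam) : SemistandardYoungTableau nu where
  entry i j := if (i, j) ∈ nu then T i j else 0
  row_weak' := by
    intro i j1 j2 hj hc
    rw [if_pos hc, if_pos (nu.up_left_mem le_rfl hj.le hc)]
    exact T.row_weak hj (h hc)
  col_strict' := by
    intro i1 i2 j hi hc
    rw [if_pos hc, if_pos (nu.up_left_mem hi.le le_rfl hc)]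
    exact T.col_strict hi (h hc)
  zeros' := fun h => if_neg h

theorem SemistandardYoungTableau.restrict_apply {lam nu : YoungDiagram}
    (T : SemistandardYoungTableau lam) (h : nu ≤ lam) (i j : ℕ) :
    T.restrict h i j = if (i, j) ∈ nu then T i j else 0 := rfl

/-- The extension of a tableau with entries less than `N` by the entry `N` on a horizontal strip. -/
def SemistandardYoungTableau.extend {lam nu : YoungDiagram} {N : ℕ}
    (T : SemistandardYoungTableau nu) (hT : T ∈ boundedSSYT N nu) (hle : nu ≤ lam)
    (hstrip : ∀ i j, (i + 1, j) ∈ lam → (i, j) ∈ nu) : SemistandardYoungTableau lam where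
  entry i j := if (i, j) ∈ nu then T i j else if (i, j) ∈ lam then N else 0
  row_weak' := by
    intro i j1 j2 hj hc
    by_cases h2 : (i, j2) ∈ nu
    · rw [if_pos h2, if_pos (nu.up_left_mem le_rfl hj.le h2)]
      exact T.row_weak hj h2
    · rw [if_neg h2, if_pos hc]
      split_ifs with h1
      · exact (hT i j1 h1).le
      · exact le_rfl
      · exact Nat.zero_le _
  col_strict' := by
    intro i1 i2 j hi hc
    have h1 : (i1, j) ∈ nu := hstrip _ _ (lam.up_left_mem (by omega) le_rfl hc)
    rw [if_pos h1]
    by_cases h2 : (i2, j) ∈ nu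
    · rw [if_pos h2]
      exact T.col_strict hi h2
    · rw [if_neg h2, if_pos hc]
      exact hT _ _ h1
  zeros' := fun h => by rw [if_neg fun h' => h (hle h'), if_neg h]

theorem SemistandardYoungTableau.extend_apply {lam nu : YoungDiagram} {N : ℕ}
    (T : SemistandardYoungTableau nu) (hT : T ∈ boundedSSYT N nu) (hle : nu ≤ lam)
    (hstrip : ∀ i j, (i + 1, j) ∈ lam → (i, j) ∈ nu) (i j : ℕ) :
    T.extend hT hle hstrip i j = if (i, j) ∈ nu then T i j else if (i, j) ∈ lam then N else 0 :=
  rfl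

/-- Restriction to `nu` is a bijection onto the tableaux with smaller entries, since every removed
cell must carry `N`. The strip condition keeps the columns strict when these cells are put back. -/
theorem sum_boundedSSYT_subDiagram_eq {R : Type*} [CommRing R] (x : ℕ → R) (N : ℕ)
    {lam nu : YoungDiagram} [DecidablePred fun T : SemistandardYoungTableau lam =>
      T.subDiagram N = nu] (hle : nu ≤ lam) (hstrip : ∀ i j, (i + 1, j) ∈ lam → (i, j) ∈ nu) :
    ∑ T ∈ (boundedSSYT_finite (N + 1) lam).toFinset with T.subDiagram N = nu,
      ∏ c ∈ lam.cells, x (T c.1 c.2) = x N ^ (lam.card - nu.card) * schurValue N nu x := by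
  rw [schurValue, Finset.mul_sum]
  have hmem : ∀ T ∈ (boundedSSYT_finite (N + 1) lam).toFinset.filter
      (fun T => T.subDiagram N = nu), ∀ i j, ((i, j) ∈ nu → T i j < N) ∧
        ((i, j) ∈ lam → (i, j) ∉ nu → T i j = N) := by
    intro T hT i j
    simp only [Finset.mem_filter, Set.Finite.mem_toFinset] at hT
    refine ⟨fun h => ?_, fun h h' => ?_⟩
    · rw [← hT.2] at h
      exact (SemistandardYoungTableau.mem_subDiagram.mp h).2
    · have h1 := hT.1 i j h
      by_contra hne
      exact h' (hT.2 ▸ SemistandardYoungTableau.mem_subDiagram.mpr ⟨h, by omega⟩)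
  refine Finset.sum_bij' (fun T _ => T.restrict hle)
    (fun T hT => T.extend ((boundedSSYT_finite N nu).mem_toFinset.mp hT) hle hstrip)
    ?_ ?_ ?_ ?_ ?_
  · intro T hT
    rw [Set.Finite.mem_toFinset]
    intro i j hc
    rw [SemistandardYoungTableau.restrict_apply, if_pos hc]
    exact (hmem T hT i j).1 hc
  · intro T hT
    rw [Finset.mem_filter, Set.Finite.mem_toFinset]
    have hT' := (boundedSSYT_finite N nu).mem_toFinset.mp hT
    constructor
    · intro i j hc
      rw [SemistandardYoungTableau.extend_apply]
      split_ifs with h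
      · exact (hT' i j h).trans (Nat.lt_succ_self N)
      · exact Nat.lt_succ_self N
    · ext ⟨i, j⟩
      rw [YoungDiagram.mem_cells, YoungDiagram.mem_cells, SemistandardYoungTableau.mem_subDiagram,
        SemistandardYoungTableau.extend_apply]
      constructor
      · rintro ⟨h1, h2⟩
        by_contra h
        rw [if_neg h, if_pos h1] at h2
        exact lt_irrefl _ h2
      · intro h
        rw [if_pos h]
        exact ⟨hle h, hT' i j h⟩
  · intro T hT
    ext i j
    rw [SemistandardYoungTableau.extend_apply, SemistandardYoungTableau.restrict_apply]
    split_ifs with h1 h2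
    · rfl
    · exact ((hmem T hT i j).2 h2 h1).symm
    · exact (T.zeros h2).symm
  · intro T hT
    ext i j
    rw [SemistandardYoungTableau.restrict_apply, SemistandardYoungTableau.extend_apply]
    split_ifs with h1
    · rfl
    · exact (T.zeros h1).symm
  · intro T hT
    rw [← Finset.prod_sdiff (YoungDiagram.cells_subset_iff.mpr hle), YoungDiagram.card,
      YoungDiagram.card, ← Finset.card_sdiff_of_subset (YoungDiagram.cells_subset_iff.mpr hle)]
    congr 1
    · refine Finset.prod_eq_pow_card ?_
      rintro ⟨i, j⟩ hc
      simp only [Finset.mem_sdiff, YoungDiagram.mem_cells] at hc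
      rw [(hmem T hT i j).2 hc.1 hc.2]
    · refine Finset.prod_congr rfl ?_
      rintro ⟨i, j⟩ hc
      rw [SemistandardYoungTableau.restrict_apply, if_pos (by simpa using hc)]

/-- The cells with the largest entry form a horizontal strip. The conditions `λ_{i+1} ≤ ν_i ≤ λ_i`
become half-open intervals after the shift, because the staircase of `ν` is one step shorter. -/
theorem schurValue_succ {R : Type*} [CommRing R] (x : ℕ → R) {N : ℕ} {lam : YoungDiagram}
    (hlam : lam.colLen 0 ≤ N + 1) :
    schurValue (N + 1) lam x
      = ∑ s ∈ Fintype.piFinset fun i : Fin N => Finset.Ico (shiftedRows (N + 1) lam i.castSucc)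
          (shiftedRows (N + 1) lam i.succ),
        x N ^ shiftedRows (N + 1) lam 0
          * (∏ i : Fin N, x N ^ (shiftedRows (N + 1) lam i.succ - 1 - s i))
          * schurValue N (ofShiftedRows s) x := by
  classical
  set t := shiftedRows (N + 1) lam with ht
  have hcol : ∀ T ∈ boundedSSYT (N + 1) lam, (T.subDiagram N).colLen 0 ≤ N := by
    intro T hT
    refine YoungDiagram.colLen_le_of_forall fun i j hc => ?_
    rw [SemistandardYoungTableau.mem_subDiagram] at hc
    exact lt_of_le_of_lt (T.row_index_le hc.1) hc.2
  have hmaps : ∀ T ∈ (boundedSSYT_finite (N + 1) lam).toFinset,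
      shiftedRows N (T.subDiagram N) ∈ Fintype.piFinset fun i : Fin N =>
        Finset.Ico (t i.castSucc) (t i.succ) := by
    intro T hT
    rw [Set.Finite.mem_toFinset] at hT
    rw [Fintype.mem_piFinset]
    intro i
    rw [Finset.mem_Ico]
    simp only [ht, shiftedRows, Fin.val_castSucc, Fin.val_succ]
    -- A cell with another cell below it has an entry less than `N`, so it survives in the
    -- subdiagram.
    have h1 : lam.rowLen (N + 1 - 1 - i) ≤ (T.subDiagram N).rowLen (N - 1 - i) := by
      by_contra! h
      have h' := YoungDiagram.mem_iff_lt_rowLen.mpr h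
      rw [show N + 1 - 1 - (i : ℕ) = N - 1 - i + 1 by omega] at h'
      have h2 := T.col_strict (show N - 1 - i < N - 1 - i + 1 by omega) h'
      have h3 := hT _ _ h'
      have h4 : (N - 1 - (i : ℕ), (T.subDiagram N).rowLen (N - 1 - i)) ∈ T.subDiagram N :=
        SemistandardYoungTableau.mem_subDiagram.mpr
          ⟨lam.up_left_mem (Nat.le_succ _) le_rfl h', by omega⟩
      exact lt_irrefl _ (YoungDiagram.mem_iff_lt_rowLen.mp h4)
    have h2 : (T.subDiagram N).rowLen (N - 1 - i) ≤ lam.rowLen (N - 1 - i) := by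
      by_contra! h
      have h' := YoungDiagram.mem_iff_lt_rowLen.mpr h
      exact lt_irrefl _ (YoungDiagram.mem_iff_lt_rowLen.mp
        (SemistandardYoungTableau.mem_subDiagram.mp h').1)
    rw [show N + 1 - 1 - ((i : ℕ) + 1) = N - 1 - i by omega]
    omega
  rw [schurValue, ← Finset.sum_fiberwise_of_maps_to hmaps]
  refine Finset.sum_congr rfl fun s hs => ?_
  rw [Fintype.mem_piFinset] at hs
  have hs' : ∀ i : Fin N, t i.castSucc ≤ s i ∧ s i < t i.succ := fun i => Finset.mem_Ico.mp (hs i)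
  have hsm : StrictMono s := by
    intro i j hij
    have := (shiftedRows_strictMono (N + 1) lam).monotone
      (show i.succ ≤ j.castSucc from Fin.le_def.mpr (by simp; omega))
    exact lt_of_lt_of_le (hs' i).2 (this.trans (hs' j).1)
  have hrow : ∀ i (_ : i < N), (ofShiftedRows s).rowLen i
      = s ⟨N - 1 - i, by omega⟩ - (N - 1 - i) := by
    intro i hi
    have := congrFun (shiftedRows_ofShiftedRows hsm) ⟨N - 1 - i, by omega⟩
    rw [← this]
    simp only [shiftedRows]
    rw [show N - 1 - (N - 1 - i) = i by omega]
    omega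
  have hb : ∀ i (hi : i < N), lam.rowLen (i + 1) ≤ (ofShiftedRows s).rowLen i ∧
      (ofShiftedRows s).rowLen i ≤ lam.rowLen i := by
    intro i hi
    have h := hs' ⟨N - 1 - i, by omega⟩
    rw [hrow i hi]
    simp only [ht, shiftedRows, Fin.val_castSucc, Fin.val_succ] at h
    rw [show N + 1 - 1 - (N - 1 - i) = i + 1 by omega,
      show N + 1 - 1 - (N - 1 - i + 1) = i by omega] at h
    omega
  have hcol' : (ofShiftedRows s).colLen 0 ≤ N :=
    YoungDiagram.colLen_le_of_forall fun i j hc => (mem_ofShiftedRows.mp hc).1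
  have hle : ofShiftedRows s ≤ lam := by
    rintro ⟨i, j⟩ hc
    have hi := (mem_ofShiftedRows.mp hc).1
    have := YoungDiagram.mem_iff_lt_rowLen.mp hc
    exact YoungDiagram.mem_iff_lt_rowLen.mpr (this.trans_le (hb i hi).2)
  have hstrip : ∀ i j, (i + 1, j) ∈ lam → (i, j) ∈ ofShiftedRows s := by
    intro i j hc
    have hi := YoungDiagram.fst_lt_of_colLen_le hlam hc
    have := YoungDiagram.mem_iff_lt_rowLen.mp hc
    exact YoungDiagram.mem_iff_lt_rowLen.mpr (this.trans_le (hb i (by omega)).1)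
  have hfilter : (boundedSSYT_finite (N + 1) lam).toFinset.filter
        (fun T => shiftedRows N (T.subDiagram N) = s)
      = (boundedSSYT_finite (N + 1) lam).toFinset.filter
        (fun T => T.subDiagram N = ofShiftedRows s) := by
    refine Finset.filter_congr fun T hT => ?_
    rw [Set.Finite.mem_toFinset] at hT
    constructor
    · intro h
      rw [← h, ofShiftedRows_shiftedRows (hcol T hT)]
    · intro h
      rw [h, shiftedRows_ofShiftedRows hsm]
  rw [hfilter, sum_boundedSSYT_subDiagram_eq x N hle hstrip]
  congr 1
  rw [Finset.prod_pow_eq_pow_sum, ← pow_add]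
  congr 1
  rw [YoungDiagram.card_eq_sum_rowLen hlam, YoungDiagram.card_eq_sum_rowLen hcol',
    Finset.sum_range_succ, ← Finset.sum_range_reflect (fun i => lam.rowLen i),
    ← Finset.sum_range_reflect (fun i => (ofShiftedRows s).rowLen i)]
  have h3 : ∀ i : Fin N, t i.succ - 1 - s i
      = lam.rowLen (N - 1 - i) - (ofShiftedRows s).rowLen (N - 1 - i) := by
    intro i
    have h1 := (hb (N - 1 - i) (by omega))
    have h2 := hrow (N - 1 - i) (by omega)
    have h4 := hs' i
    have e : (⟨N - 1 - (N - 1 - i), by omega⟩ : Fin N) = i := Fin.ext (by simp; omega)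
    rw [e] at h2
    simp only [ht, shiftedRows, Fin.val_succ, Fin.val_castSucc] at h4 ⊢
    rw [show N + 1 - 1 - ((i : ℕ) + 1) = N - 1 - i by omega] at *
    omega
  simp only [h3]
  rw [← Finset.sum_range (fun i => lam.rowLen (N - 1 - i) - (ofShiftedRows s).rowLen (N - 1 - i)),
    Finset.sum_tsub_distrib]
  · have h5 : ∑ i ∈ Finset.range N, (ofShiftedRows s).rowLen (N - 1 - i)
        ≤ ∑ i ∈ Finset.range N, lam.rowLen (N - 1 - i) :=
      Finset.sum_le_sum fun i hi => (hb (N - 1 - i) (by rw [Finset.mem_range] at hi; omega)).2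
    have h6 : t 0 = lam.rowLen N := by simp [ht, shiftedRows]
    omega
  · intro i hi
    exact (hb (N - 1 - i) (by rw [Finset.mem_range] at hi; omega)).2

/-- The bialternant formula. -/
theorem schurValue_mul_staircaseAlternant {R : Type*} [CommRing R] (x : ℕ → R) {n : ℕ}
    {lam : YoungDiagram} (hlam : lam.colLen 0 ≤ n) :
    schurValue n lam x * staircaseAlternant x n = alternant x (shiftedRows n lam) := by
  induction n generalizing lam with
  | zero =>
    have hbot : ∀ i j, (i, j) ∉ lam := fun i j h =>
      absurd (YoungDiagram.fst_lt_of_colLen_le hlam h) (Nat.not_lt_zero i)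
    have hcells : lam.cells = ∅ := Finset.eq_empty_of_forall_notMem fun c hc => hbot c.1 c.2 hc
    have hset : (boundedSSYT_finite 0 lam).toFinset = {default} := by
      ext T
      simp only [Set.Finite.mem_toFinset, Finset.mem_singleton]
      constructor
      · intro _
        ext i j
        rw [T.zeros (hbot i j), SemistandardYoungTableau.zeros _ (hbot i j)]
      · intro _ i j h
        exact absurd h (hbot i j)
    simp [schurValue, hset, hcells, staircaseAlternant, alternant]
  | succ n ih =>
    -- Both sides become the same sum over `s`: branching on the left, the expanded gap determinant
    -- on the right.
    rw [schurValue_succ x hlam, staircaseAlternant_succ,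
      alternant_succ x (shiftedRows_strictMono (n + 1) lam).monotone,
      ← sum_schur_branching_alternant, Finset.mul_sum, Finset.sum_mul]
    refine Finset.sum_congr rfl fun s hs => ?_
    have hcol' : (ofShiftedRows s).colLen 0 ≤ n :=
      YoungDiagram.colLen_le_of_forall fun i j hc => (mem_ofShiftedRows.mp hc).1
    have hsm : StrictMono s := by
      rw [Fintype.mem_piFinset] at hs
      intro i j hij
      have := (shiftedRows_strictMono (n + 1) lam).monotone
        (show i.succ ≤ j.castSucc from Fin.le_def.mpr (by simp; omega))
      exact lt_of_lt_of_le (Finset.mem_Ico.mp (hs i)).2 (this.trans (Finset.mem_Ico.mp (hs j)).1)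
    have h := ih hcol'
    rw [shiftedRows_ofShiftedRows hsm] at h
    rw [← h]
    ring

/-! ### Row weights in terms of column states -/

/-- The sum of the entries weakly to the right of `q` in the row taking the column state `S`
to `S'`. -/
def rowSuffix {m : ℕ} (S S' : Finset (Fin m)) (q : Fin m) : ℤ :=
  ((S'.filter (q ≤ ·)).card : ℤ) - (S.filter (q ≤ ·)).card

/-- The column states `S`, `S'` are joined by a row of an alternating sign matrix. -/
structure IsRowStep {m : ℕ} (S S' : Finset (Fin m)) : Prop where
  card : S'.card = S.card + 1
  suffix : ∀ q, rowSuffix S S' q = 0 ∨ rowSuffix S S' q = 1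

/-- The positions of the entries `NE` in the row joining `S` to `S'`. -/
def rowNE {m : ℕ} (S S' : Finset (Fin m)) : Finset (Fin m) :=
  Finset.univ.filter fun q => q ∉ S ∧ q ∉ S' ∧ rowSuffix S S' q = 1

/-- The positions of the entries `SE` in the row joining `S` to `S'`. -/
def rowSE {m : ℕ} (S S' : Finset (Fin m)) : Finset (Fin m) :=
  Finset.univ.filter fun q => q ∈ S ∧ q ∈ S' ∧ rowSuffix S S' q = 1

open Classical in
/-- The weight of the row joining `S` to `S'`. -/
noncomputable def rowWeight {R : Type*} [CommRing R] {m : ℕ} (x y : R) (S S' : Finset (Fin m)) :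
    R :=
  if IsRowStep S S' then x ^ (rowNE S S').card * y ^ (rowSE S S').card * (x + y) ^ (S \ S').card
  else 0

theorem rowSuffix_compl {m : ℕ} (S S' : Finset (Fin m)) (q : Fin m) :
    rowSuffix S'ᶜ Sᶜ q = rowSuffix S S' q := by
  have h : ∀ U : Finset (Fin m), (U.filter (q ≤ ·)).card + (Uᶜ.filter (q ≤ ·)).card
      = (Finset.univ.filter (q ≤ · : Fin m → Prop)).card := by
    intro U
    rw [← Finset.card_union_of_disjoint, ← Finset.filter_union, Finset.union_compl]
    exact Finset.disjoint_filter_filter disjoint_compl_right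
  have h1 := h S
  have h2 := h S'
  simp only [rowSuffix]
  omega

theorem IsRowStep.compl {m : ℕ} {S S' : Finset (Fin m)} (h : IsRowStep S S') :
    IsRowStep S'ᶜ Sᶜ where
  card := by
    have h1 := S.card_compl_add_card
    have h2 := S'.card_compl_add_card
    have := h.card
    omega
  suffix q := by rw [rowSuffix_compl]; exact h.suffix q

/-- Turning a row upside down and complementing its states keeps every suffix sum. Columns in
neither state and columns in both states are exchanged, hence so are NE and SE, while the NS
positions stay. -/
theorem rowWeight_compl {R : Type*} [CommRing R] {m : ℕ} (x y : R) (S S' : Finset (Fin m)) :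
    rowWeight y x S'ᶜ Sᶜ = rowWeight x y S S' := by
  have hiff : IsRowStep S'ᶜ Sᶜ ↔ IsRowStep S S' :=
    ⟨fun h => by simpa using h.compl, fun h => h.compl⟩
  have h1 : rowNE S'ᶜ Sᶜ = rowSE S S' := by
    ext q; simp [rowNE, rowSE, rowSuffix_compl]; tauto
  have h2 : rowSE S'ᶜ Sᶜ = rowNE S S' := by
    ext q; simp [rowNE, rowSE, rowSuffix_compl]; tauto
  have h3 : S'ᶜ \ Sᶜ = S \ S' := by
    ext q; simp; tauto
  by_cases h : IsRowStep S S'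
  · rw [rowWeight, rowWeight, if_pos h, if_pos (hiff.mpr h), h1, h2, h3]
    ring
  · rw [rowWeight, rowWeight, if_neg h, if_neg fun h' => h (hiff.mp h')]

theorem StrictMono.lt_card_filter_lt_iff {n m : ℕ} {t : Fin n → Fin m} (ht : StrictMono t)
    (q : Fin m) (i : Fin n) : (i : ℕ) < (Finset.univ.filter (t · < q)).card ↔ t i < q := by
  constructor
  · intro h
    by_contra! hq
    have hsub : Finset.univ.filter (t · < q) ⊆ Finset.Iio i := by
      intro j hj
      rw [Finset.mem_filter] at hj
      rw [Finset.mem_Iio]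
      exact ht.lt_iff_lt.mp (hj.2.trans_le hq)
    have := Finset.card_le_card hsub
    rw [Fin.card_Iio] at this
    omega
  · intro h
    have hsub : Finset.Iic i ⊆ Finset.univ.filter (t · < q) := by
      intro j hj
      rw [Finset.mem_Iic] at hj
      simpa using (ht.monotone hj).trans_lt h
    have := Finset.card_le_card hsub
    rw [Fin.card_Iic] at this
    omega

theorem StrictMono.card_filter_lt_self {n m : ℕ} {t : Fin n → Fin m} (ht : StrictMono t)
    (i : Fin n) : (Finset.univ.filter (t · < t i)).card = i := by
  have : Finset.univ.filter (t · < t i) = Finset.Iio i := by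
    ext j; simp [ht.lt_iff_lt]
  rw [this, Fin.card_Iio]

theorem card_filter_le_image_add {n m : ℕ} {t : Fin n → Fin m} (ht : StrictMono t) (q : Fin m) :
    ((Finset.univ.image t).filter (q ≤ ·)).card + (Finset.univ.filter (t · < q)).card = n := by
  rw [Finset.filter_image, Finset.card_image_of_injective _ ht.injective, add_comm]
  have := Finset.card_filter_add_card_filter_not (s := (Finset.univ : Finset (Fin n))) (t · < q)
  simpa using this

theorem sum_card_filter_le {m : ℕ} (S : Finset (Fin m)) :
    ∑ q, (S.filter (q ≤ ·)).card = ∑ p ∈ S, ((p : ℕ) + 1) := by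
  simp only [Finset.card_filter]
  rw [Finset.sum_comm]
  refine Finset.sum_congr rfl fun p _ => ?_
  rw [← Finset.card_filter, ← Fin.card_Iic p]
  congr 1
  ext q; simp

/-! ### Interlacing and the splitting of a row weight over gaps -/

section Interlacing

variable {m k : ℕ} {s : Fin k → Fin m} {t : Fin (k + 1) → Fin m}

theorem rowSuffix_image (hs : StrictMono s) (ht : StrictMono t) (q : Fin m) :
    rowSuffix (Finset.univ.image s) (Finset.univ.image t) q
      = 1 - (Finset.univ.filter (t · < q)).card + (Finset.univ.filter (s · < q)).card := by
  have h1 := card_filter_le_image_add hs q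
  have h2 := card_filter_le_image_add ht q
  simp only [rowSuffix]
  omega

/-- Suffix sums in `{0, 1}` say that, below any column, `t` has as many elements as `s` or one more.
Testing this at the elements themselves is interlacing. -/
theorem isRowStep_image_iff (hs : StrictMono s) (ht : StrictMono t) :
    IsRowStep (Finset.univ.image s) (Finset.univ.image t)
      ↔ ∀ i : Fin k, t i.castSucc ≤ s i ∧ s i ≤ t i.succ := by
  constructor
  · intro h i
    have hq : ∀ q, (Finset.univ.filter (s · < q)).card ≤ (Finset.univ.filter (t · < q)).card ∧
        (Finset.univ.filter (t · < q)).card ≤ (Finset.univ.filter (s · < q)).card + 1 := by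
      intro q
      have := h.suffix q
      rw [rowSuffix_image hs ht] at this
      omega
    constructor
    · by_contra! hlt
      have h1 := (hs.lt_card_filter_lt_iff _ i).mpr hlt
      have h2 := (hq (t i.castSucc)).1
      rw [ht.card_filter_lt_self, Fin.val_castSucc] at h2
      omega
    · by_contra! hlt
      have h1 := (ht.lt_card_filter_lt_iff _ i.succ).mpr hlt
      have h2 := (hq (s i)).2
      rw [hs.card_filter_lt_self] at h2
      rw [Fin.val_succ] at h1
      omega
  · intro h
    refine ⟨?_, fun q => ?_⟩
    · rw [Finset.card_image_of_injective _ hs.injective,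
        Finset.card_image_of_injective _ ht.injective]
      simp
    · rw [rowSuffix_image hs ht]
      have h1 : (Finset.univ.filter (s · < q)).card ≤ (Finset.univ.filter (t · < q)).card := by
        by_contra! hlt
        have hk : (Finset.univ.filter (t · < q)).card < k :=
          hlt.trans_le ((Finset.card_le_univ _).trans (by simp))
        have h1 := (hs.lt_card_filter_lt_iff q ⟨_, hk⟩).mp hlt
        have h2 := (ht.lt_card_filter_lt_iff q (Fin.castSucc ⟨_, hk⟩)).mpr ((h _).1.trans_lt h1)
        simp at h2
      have h2 : (Finset.univ.filter (t · < q)).card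
          ≤ (Finset.univ.filter (s · < q)).card + 1 := by
        by_contra! hlt
        have hk : (Finset.univ.filter (s · < q)).card < k := by
          have : (Finset.univ.filter (t · < q)).card ≤ k + 1 :=
            (Finset.card_le_univ _).trans (by simp)
          omega
        have h1 := (ht.lt_card_filter_lt_iff q (Fin.succ ⟨_, hk⟩)).mp (by simpa using hlt)
        have h2 := (hs.lt_card_filter_lt_iff q ⟨_, hk⟩).mpr ((h _).2.trans_lt h1)
        simp at h2
      omega

theorem mem_image_upper_iff (ht : StrictMono t)
    (h : ∀ i : Fin k, t i.castSucc ≤ s i ∧ s i ≤ t i.succ) (i : Fin k) :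
    s i ∈ Finset.univ.image t ↔ s i = t i.castSucc ∨ s i = t i.succ := by
  simp only [Finset.mem_image, Finset.mem_univ, true_and]
  constructor
  · rintro ⟨j, hj⟩
    have h1 := ht.le_iff_le.mp (hj ▸ (h i).1)
    have h2 := ht.le_iff_le.mp (hj ▸ (h i).2)
    rw [Fin.le_def] at h1 h2
    simp only [Fin.val_castSucc, Fin.val_succ] at h1 h2
    rcases (by omega : (j : ℕ) = i ∨ (j : ℕ) = i + 1) with e | e
    · left; rw [← hj]; congr 1; exact Fin.ext e
    · right; rw [← hj]; congr 1; exact Fin.ext e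
  · rintro (e | e)
    · exact ⟨_, e.symm⟩
    · exact ⟨_, e.symm⟩

/-- A common element of both states is the left or the right end of its gap. The suffix sum there is
1 at the left end and 0 at the right end. -/
theorem rowSE_image (hs : StrictMono s) (ht : StrictMono t)
    (h : ∀ i : Fin k, t i.castSucc ≤ s i ∧ s i ≤ t i.succ) :
    rowSE (Finset.univ.image s) (Finset.univ.image t)
      = (Finset.univ.filter fun i => s i = t i.castSucc).image s := by
  ext q
  rw [rowSE, Finset.mem_filter, rowSuffix_image hs ht]
  simp only [Finset.mem_univ, true_and]
  constructor
  · rintro ⟨h1, h2, h3⟩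
    obtain ⟨i, -, rfl⟩ := Finset.mem_image.mp h1
    obtain ⟨j, -, hj⟩ := Finset.mem_image.mp h2
    refine Finset.mem_image_of_mem _ (Finset.mem_filter.mpr ⟨Finset.mem_univ _, ?_⟩)
    rw [hs.card_filter_lt_self, ← hj, ht.card_filter_lt_self] at h3
    rw [← hj]
    congr 1
    ext
    simp only [Fin.val_castSucc]
    omega
  · intro h1
    obtain ⟨i, hi, rfl⟩ := Finset.mem_image.mp h1
    have hi' := (Finset.mem_filter.mp hi).2
    refine ⟨Finset.mem_image_of_mem _ (Finset.mem_univ _),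
      (mem_image_upper_iff ht h i).mpr (Or.inl hi'), ?_⟩
    rw [hs.card_filter_lt_self, hi', ht.card_filter_lt_self, Fin.val_castSucc]
    omega

theorem image_sdiff_image (ht : StrictMono t)
    (h : ∀ i : Fin k, t i.castSucc ≤ s i ∧ s i ≤ t i.succ) :
    Finset.univ.image s \ Finset.univ.image t
      = (Finset.univ.filter fun i => s i ≠ t i.castSucc ∧ s i ≠ t i.succ).image s := by
  ext q
  rw [Finset.mem_sdiff]
  constructor
  · rintro ⟨h1, h2⟩
    obtain ⟨i, -, rfl⟩ := Finset.mem_image.mp h1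
    rw [mem_image_upper_iff ht h] at h2
    exact Finset.mem_image_of_mem _ (by simpa using h2)
  · intro h1
    obtain ⟨i, hi, rfl⟩ := Finset.mem_image.mp h1
    rw [mem_image_upper_iff ht h]
    exact ⟨Finset.mem_image_of_mem _ (Finset.mem_univ _), by simpa using hi⟩

theorem rowSuffix_eq_one_of_mem (hs : StrictMono s) (ht : StrictMono t)
    (h : ∀ i : Fin k, t i.castSucc ≤ s i ∧ s i ≤ t i.succ) {q : Fin m}
    (h1 : q ∈ Finset.univ.image t) (h2 : q ∉ Finset.univ.image s) :
    rowSuffix (Finset.univ.image s) (Finset.univ.image t) q = 1 := by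
  have hstep := ((isRowStep_image_iff hs ht).mpr h).suffix q
  rw [rowSuffix_image hs ht] at hstep ⊢
  obtain ⟨i, -, rfl⟩ := Finset.mem_image.mp h1
  rw [ht.card_filter_lt_self] at hstep ⊢
  suffices (i : ℕ) ≤ (Finset.univ.filter (s · < t i)).card by omega
  induction i using Fin.cases with
  | zero => simp
  | succ i =>
    have hne : s i ≠ t i.succ := fun e => h2 (e ▸ Finset.mem_image_of_mem _ (Finset.mem_univ _))
    have := (hs.lt_card_filter_lt_iff (t i.succ) i).mpr (lt_of_le_of_ne (h i).2 hne)
    simpa using this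

theorem rowSuffix_eq_zero_of_mem (hs : StrictMono s) (ht : StrictMono t)
    (h : ∀ i : Fin k, t i.castSucc ≤ s i ∧ s i ≤ t i.succ) {q : Fin m}
    (h1 : q ∈ Finset.univ.image s) (h2 : q ∉ Finset.univ.image t) :
    rowSuffix (Finset.univ.image s) (Finset.univ.image t) q = 0 := by
  have hstep := ((isRowStep_image_iff hs ht).mpr h).suffix q
  rw [rowSuffix_image hs ht] at hstep ⊢
  obtain ⟨i, -, rfl⟩ := Finset.mem_image.mp h1
  rw [hs.card_filter_lt_self] at hstep ⊢
  have hne : t i.castSucc ≠ s i :=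
    fun e => h2 (e ▸ Finset.mem_image_of_mem _ (Finset.mem_univ _))
  have := (ht.lt_card_filter_lt_iff (s i) i.castSucc).mpr (lt_of_le_of_ne (h i).1 hne)
  rw [Fin.val_castSucc] at this
  omega

/-- The suffix sum is 1 exactly at the NE, SE and WE positions, so adding all suffix sums counts
these. Double counting gives the same total from the elements of the states, and a row has one more
WE than NS. -/
theorem card_rowNE_image (hs : StrictMono s) (ht : StrictMono t)
    (h : ∀ i : Fin k, t i.castSucc ≤ s i ∧ s i ≤ t i.succ) :
    (rowNE (Finset.univ.image s) (Finset.univ.image t)).card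
      + (rowSE (Finset.univ.image s) (Finset.univ.image t)).card
      + (Finset.univ.image s \ Finset.univ.image t).card + ∑ i, (s i : ℕ) = ∑ i, (t i : ℕ) := by
  set S := Finset.univ.image s with hS
  set S' := Finset.univ.image t with hS'
  have hstep := (isRowStep_image_iff hs ht).mpr h
  have hsum : ∑ q, rowSuffix S S' q
      = ((rowNE S S').card : ℤ) + (rowSE S S').card + (S' \ S).card := by
    have hq : ∀ q, rowSuffix S S' q = ((if q ∈ rowNE S S' then 1 else 0)
        + (if q ∈ rowSE S S' then 1 else 0)) + if q ∈ S' \ S then 1 else 0 := by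
      intro q
      have hcase := hstep.suffix q
      have h1 := @rowSuffix_eq_one_of_mem m k s t hs ht h q
      have h2 := @rowSuffix_eq_zero_of_mem m k s t hs ht h q
      simp only [← hS, ← hS'] at hcase h1 h2
      simp only [rowNE, rowSE, Finset.mem_filter, Finset.mem_univ, true_and, Finset.mem_sdiff]
      by_cases a : q ∈ S <;> by_cases b : q ∈ S' <;> rcases hcase with c | c <;>
        simp_all
    rw [Finset.sum_congr rfl fun q _ => hq q, Finset.sum_add_distrib, Finset.sum_add_distrib]
    simp only [Finset.sum_ite_mem, Finset.univ_inter, Finset.sum_const, nsmul_eq_mul, mul_one]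
  have hsum' : ∑ q, rowSuffix S S' q
      = ((∑ i, (t i : ℕ) : ℕ) : ℤ) + 1 - ((∑ i, (s i : ℕ) : ℕ) : ℤ) := by
    simp only [rowSuffix]
    rw [Finset.sum_sub_distrib, ← Nat.cast_sum, ← Nat.cast_sum, sum_card_filter_le,
      sum_card_filter_le, hS, hS', Finset.sum_image fun _ _ _ _ e => hs.injective e,
      Finset.sum_image fun _ _ _ _ e => ht.injective e, Finset.sum_add_distrib,
      Finset.sum_add_distrib]
    simp only [Finset.sum_const, Finset.card_univ, Fintype.card_fin]
    push_cast
    simp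
    ring
  have hcard : (S' \ S).card = (S \ S').card + 1 := by
    have h1 := Finset.card_sdiff_add_card_inter S S'
    have h2 := Finset.card_sdiff_add_card_inter S' S
    have h3 : S'.card = S.card + 1 := hstep.card
    rw [Finset.inter_comm] at h2
    omega
  omega

theorem gapWeight_eq {R : Type*} [CommRing R] (x y : R) {a b c : ℕ} (hab : a < b) (hac : a ≤ c)
    (hcb : c ≤ b) :
    gapWeight x y a b c
      = x ^ (b - c - ((if c = a then 1 else 0) + if c ≠ a ∧ c ≠ b then 1 else 0))
        * y ^ (if c = a then 1 else 0) * (x + y) ^ (if c ≠ a ∧ c ≠ b then 1 else 0) := by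
  rcases eq_or_lt_of_le hac with rfl | hac'
  · rw [gapWeight, if_neg (lt_irrefl _), if_pos hab]
    simp
    rw [Nat.sub_right_comm]
    ring
  · rcases eq_or_lt_of_le hcb with rfl | hcb'
    · simp [gapWeight, hac', hac'.ne']
    · have : b - c = (b - 1 - c) + 1 := by omega
      simp only [gapWeight, hac', hcb', hac'.ne', hcb'.ne, if_true, if_false, ne_eq,
        not_false_eq_true, and_self]
      rw [this]
      simp
      ring

/-- SE and NS are counted gap by gap: `s i` is at the left end, or strictly inside. The exponent of
`x` then follows from the total count; the part not absorbed by gaps is `t 0`. -/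
theorem rowWeight_image {R : Type*} [CommRing R] (x y : R) (hs : StrictMono s) (ht : StrictMono t)
    (h : ∀ i : Fin k, t i.castSucc ≤ s i ∧ s i ≤ t i.succ) :
    rowWeight x y (Finset.univ.image s) (Finset.univ.image t)
      = x ^ (t 0 : ℕ) * ∏ i : Fin k, gapWeight x y (t i.castSucc) (t i.succ) (s i) := by
  have hlt : ∀ i : Fin k, (t i.castSucc : ℕ) < t i.succ := fun i => ht Fin.castSucc_lt_succ
  have hg : ∀ i : Fin k, gapWeight x y (t i.castSucc) (t i.succ) (s i) = _ :=
    fun i => gapWeight_eq x y (hlt i) (h i).1 (h i).2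
  rw [rowWeight, if_pos ((isRowStep_image_iff hs ht).mpr h)]
  have hNE := card_rowNE_image hs ht h
  have hSE : (rowSE (Finset.univ.image s) (Finset.univ.image t)).card
      = ∑ i : Fin k, if (s i : ℕ) = t i.castSucc then 1 else 0 := by
    rw [rowSE_image hs ht h, Finset.card_image_of_injective _ hs.injective, Finset.card_filter]
    simp only [Fin.ext_iff]
  have hNS : (Finset.univ.image s \ Finset.univ.image t).card
      = ∑ i : Fin k, if (s i : ℕ) ≠ t i.castSucc ∧ (s i : ℕ) ≠ t i.succ then 1 else 0 := by
    rw [image_sdiff_image ht h, Finset.card_image_of_injective _ hs.injective, Finset.card_filter]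
    simp only [ne_eq, Fin.ext_iff]
  rw [Finset.prod_congr rfl fun i _ => hg i, Finset.prod_mul_distrib, Finset.prod_mul_distrib,
    Finset.prod_pow_eq_pow_sum, Finset.prod_pow_eq_pow_sum, Finset.prod_pow_eq_pow_sum, ← hSE,
    ← hNS, ← mul_assoc, ← mul_assoc, ← pow_add]
  congr 3
  have he : ∑ i : Fin k, ((t i.succ : ℕ) - s i - ((if (s i : ℕ) = t i.castSucc then 1 else 0)
        + if (s i : ℕ) ≠ t i.castSucc ∧ (s i : ℕ) ≠ t i.succ then 1 else 0))
      + (∑ i : Fin k, if (s i : ℕ) = t i.castSucc then 1 else 0)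
      + (∑ i : Fin k, if (s i : ℕ) ≠ t i.castSucc ∧ (s i : ℕ) ≠ t i.succ then 1 else 0)
      + ∑ i, (s i : ℕ) = ∑ i : Fin k, (t i.succ : ℕ) := by
    rw [← Finset.sum_add_distrib, ← Finset.sum_add_distrib, ← Finset.sum_add_distrib]
    refine Finset.sum_congr rfl fun i _ => ?_
    have h1 : (t i.castSucc : ℕ) ≤ s i := (h i).1
    have h2 : (s i : ℕ) ≤ t i.succ := (h i).2
    have h3 := hlt i
    split_ifs <;> omega
  rw [Fin.sum_univ_succ] at hNE
  omega

end Interlacing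

theorem rowWeight_of_card_ne {R : Type*} [CommRing R] {m : ℕ} (x y : R) {S S' : Finset (Fin m)}
    (h : S'.card ≠ S.card + 1) : rowWeight x y S S' = 0 :=
  if_neg fun h' => h h'.card

/-! ### The partition function of the top rows -/

/-- The alternant whose exponents are the elements of a finite set. -/
noncomputable def setAlternant {R : Type*} [CommRing R] (x : ℕ → R) {m : ℕ} (S : Finset (Fin m)) :
    R :=
  alternant x fun i : Fin S.card => (S.orderEmbOfFin rfl i : ℕ)

theorem setAlternant_image {R : Type*} [CommRing R] (x : ℕ → R) {m k : ℕ} {s : Fin k → Fin m}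
    (hs : StrictMono s) :
    setAlternant x (Finset.univ.image s) = alternant x fun i => (s i : ℕ) := by
  have hcard : (Finset.univ.image s).card = k := by
    rw [Finset.card_image_of_injective _ hs.injective]; simp
  have h : ∀ (S : Finset (Fin m)) (k : ℕ) (hc : S.card = k),
      setAlternant x S = alternant x fun i : Fin k => (S.orderEmbOfFin hc i : ℕ) := by
    intro S k hc
    subst hc
    rfl
  rw [h _ k hcard, ← Finset.orderEmbOfFin_unique hcard
    (fun i => Finset.mem_image_of_mem s (Finset.mem_univ i)) hs]

/-- One row acts on alternants almost diagonally: both sides are multiples of the same gap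
determinant. The product of differences stands on the left to avoid division. -/
theorem sum_setAlternant_mul_rowWeight {R : Type*} [CommRing R] (x : ℕ → R) (y : R) {m k : ℕ}
    {S' : Finset (Fin m)} (hS' : S'.card = k + 1) :
    (∏ j ∈ Finset.range k, (x k - x j))
        * ∑ S with S.card = k, setAlternant x S * rowWeight (x k) y S S'
      = (∏ j ∈ Finset.range k, (x j + y)) * setAlternant x S' := by
  classical
  obtain ⟨t, ht, rfl⟩ : ∃ t : Fin (k + 1) → Fin m, StrictMono t ∧ S' = Finset.univ.image t :=
    ⟨S'.orderEmbOfFin hS', (S'.orderEmbOfFin hS').strictMono, by simp⟩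
  have htN : StrictMono fun i => (t i : ℕ) := fun i j h => ht h
  have key : ∑ S with S.card = k, setAlternant x S * rowWeight (x k) y S (Finset.univ.image t)
      = x k ^ (t 0 : ℕ) * ∑ s ∈ Fintype.piFinset fun i : Fin k =>
          Finset.Icc (t i.castSucc : ℕ) (t i.succ),
        (∏ i : Fin k, gapWeight (x k) y (t i.castSucc) (t i.succ) (s i)) * alternant x s := by
    rw [Finset.mul_sum]
    symm
    -- Closed intervals of neighbouring gaps share an endpoint; sequences using it twice are not
    -- states, but their alternants vanish.
    rw [← Finset.sum_filter_of_ne (p := fun s => Function.Injective s)]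
    swap
    · intro s _ hne
      by_contra hinj
      exact hne (by rw [alternant_eq_zero_of_not_injective x hinj]; ring)
    rw [← Finset.sum_filter_of_ne (p := fun S => IsRowStep S (Finset.univ.image t))
      (s := Finset.univ.filter fun S => S.card = k)]
    swap
    · intro S _ hne
      by_contra h
      exact hne (by rw [rowWeight, if_neg h]; ring)
    have hprop : ∀ s ∈ (Fintype.piFinset fun i : Fin k =>
        Finset.Icc (t i.castSucc : ℕ) (t i.succ)).filter (fun s => Function.Injective s),
        (∀ i, (t i.castSucc : ℕ) ≤ s i ∧ s i ≤ t i.succ) ∧ StrictMono s := by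
      intro s hs
      rw [Finset.mem_filter, Fintype.mem_piFinset] at hs
      have h1 : ∀ i, (t i.castSucc : ℕ) ≤ s i ∧ s i ≤ t i.succ :=
        fun i => Finset.mem_Icc.mp (hs.1 i)
      refine ⟨h1, fun i j hij => lt_of_le_of_ne ?_ fun e => hij.ne (hs.2 e)⟩
      have h2 := htN.monotone (show i.succ ≤ j.castSucc from Fin.le_def.mpr (by simp; omega))
      exact (h1 i).2.trans (h2.trans (h1 j).1)
    refine Finset.sum_bij (fun s hs => Finset.univ.image fun i : Fin k =>
      (⟨s i, ((hprop s hs).1 i).2.trans_lt (t i.succ).isLt⟩ : Fin m)) ?_ ?_ ?_ ?_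
    · intro s hs
      obtain ⟨h1, h2⟩ := hprop s hs
      have hmono : StrictMono fun i : Fin k =>
          (⟨s i, (h1 i).2.trans_lt (t i.succ).isLt⟩ : Fin m) := fun i j hij => h2 hij
      rw [Finset.mem_filter, Finset.mem_filter, isRowStep_image_iff hmono ht,
        Finset.card_image_of_injective _ hmono.injective]
      exact ⟨⟨Finset.mem_univ _, by simp⟩, h1⟩
    · intro s hs s' hs' e
      obtain ⟨h1, h2⟩ := hprop s hs
      obtain ⟨h1', h2'⟩ := hprop s' hs'
      have hmono : StrictMono fun i : Fin k =>
          (⟨s i, (h1 i).2.trans_lt (t i.succ).isLt⟩ : Fin m) := fun i j hij => h2 hij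
      have hmono' : StrictMono fun i : Fin k =>
          (⟨s' i, (h1' i).2.trans_lt (t i.succ).isLt⟩ : Fin m) := fun i j hij => h2' hij
      have hcard : (Finset.univ.image fun i : Fin k =>
          (⟨s i, (h1 i).2.trans_lt (t i.succ).isLt⟩ : Fin m)).card = k := by
        rw [Finset.card_image_of_injective _ hmono.injective]; simp
      have e1 := Finset.orderEmbOfFin_unique hcard
        (fun i => Finset.mem_image_of_mem _ (Finset.mem_univ i)) hmono
      have e2 := Finset.orderEmbOfFin_unique hcard
        (fun i => by rw [e]; exact Finset.mem_image_of_mem _ (Finset.mem_univ i)) hmono'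
      funext i
      have := congrFun (e1.trans e2.symm) i
      exact congrArg Fin.val this
    · intro S hS
      rw [Finset.mem_filter, Finset.mem_filter] at hS
      have hmono := (S.orderEmbOfFin hS.1.2).strictMono
      have himg : S = Finset.univ.image (S.orderEmbOfFin hS.1.2) := by simp
      have hstep := hS.2
      rw [himg, isRowStep_image_iff hmono ht] at hstep
      refine ⟨fun i => (S.orderEmbOfFin hS.1.2 i : ℕ), ?_, ?_⟩
      · rw [Finset.mem_filter, Fintype.mem_piFinset]
        exact ⟨fun i => Finset.mem_Icc.mpr (hstep i), fun i j e => hmono.injective (Fin.ext e)⟩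
      · simp
    · intro s hs
      obtain ⟨h1, h2⟩ := hprop s hs
      have hmono : StrictMono fun i : Fin k =>
          (⟨s i, (h1 i).2.trans_lt (t i.succ).isLt⟩ : Fin m) := fun i j hij => h2 hij
      rw [rowWeight_image _ _ hmono ht h1, setAlternant_image x hmono]
      ring
  rw [key, setAlternant_image x ht, sum_gapWeight_alternant x y (fun i => (t i : ℕ)),
    alternant_succ x htN.monotone]
  ring

/-- The sum over all paths of length `k` from `a` to a given point of the products of the step
weights `T`. -/
def pathSum {R α : Type*} [CommRing R] [Fintype α] [DecidableEq α] (T : ℕ → α → α → R) (a : α) :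
    ℕ → α → R
  | 0, c => if c = a then 1 else 0
  | k + 1, c => ∑ b, pathSum T a k b * T k b c

/-- The partition function of the first `k` rows with final column state `S`. -/
noncomputable def topWeight {R : Type*} [CommRing R] (x y : ℕ → R) {m : ℕ} (k : ℕ)
    (S : Finset (Fin m)) : R :=
  pathSum (fun k => rowWeight (x k) (y k)) ∅ k S

theorem topWeight_succ {R : Type*} [CommRing R] (x y : ℕ → R) {m : ℕ} (k : ℕ)
    (S' : Finset (Fin m)) :
    topWeight x y (k + 1) S' = ∑ S, topWeight x y k S * rowWeight (x k) (y k) S S' := rfl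

theorem topWeight_of_card_ne {R : Type*} [CommRing R] (x y : ℕ → R) {m : ℕ} (k : ℕ)
    {S : Finset (Fin m)} (h : S.card ≠ k) : topWeight x y k S = 0 := by
  induction k generalizing S with
  | zero =>
    rw [topWeight, pathSum, if_neg]
    rintro rfl
    exact h rfl
  | succ k ih =>
    rw [topWeight_succ]
    refine Finset.sum_eq_zero fun U _ => ?_
    by_cases hU : U.card = k
    · rw [rowWeight_of_card_ne _ _ (by rw [hU]; exact h), mul_zero]
    · rw [ih hU, zero_mul]

theorem topWeight_mul_staircaseAlternant {R : Type*} [CommRing R] (x y : ℕ → R) {m : ℕ} (k : ℕ)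
    {S : Finset (Fin m)} (h : S.card = k) :
    topWeight x y k S * staircaseAlternant x k
      = (∏ j ∈ Finset.range k, ∏ i ∈ Finset.range j, (x i + y j)) * setAlternant x S := by
  induction k generalizing S with
  | zero =>
    obtain rfl := Finset.card_eq_zero.mp h
    have : IsEmpty (Fin (∅ : Finset (Fin m)).card) := by rw [Finset.card_empty]; infer_instance
    have h1 : setAlternant x (∅ : Finset (Fin m)) = 1 := Matrix.det_isEmpty
    simp [topWeight, pathSum, staircaseAlternant, alternant, h1]
  | succ k ih =>
    rw [topWeight_succ, staircaseAlternant_succ, Finset.prod_range_succ, mul_assoc,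
      ← sum_setAlternant_mul_rowWeight x (y k) h,
      ← Finset.sum_filter_of_ne (p := fun U => U.card = k)]
    · rw [Finset.sum_mul, Finset.mul_sum, Finset.mul_sum]
      refine Finset.sum_congr rfl fun U hU => ?_
      have := ih (Finset.mem_filter.mp hU).2
      linear_combination (rowWeight (x k) (y k) U S * ∏ j ∈ Finset.range k, (x k - x j)) * this
    · intro U _ hne
      by_contra hU
      exact hne (by rw [topWeight_of_card_ne x y k hU, zero_mul])

/-! ### Composition, reversal and splitting of path sums -/

section PathSum

variable {R α : Type*} [CommRing R] [Fintype α] [DecidableEq α]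

/-- The hypothesis is weighted by the path sum, so step weights may differ at points that no path of
nonzero weight reaches. -/
theorem pathSum_congr {T T' : ℕ → α → α → R} {a : α} {k : ℕ}
    (h : ∀ i, i < k → ∀ b c, pathSum T a i b * T i b c = pathSum T a i b * T' i b c) (c : α) :
    pathSum T a k c = pathSum T' a k c := by
  induction k generalizing c with
  | zero => rfl
  | succ k ih =>
    rw [pathSum, pathSum]
    refine Finset.sum_congr rfl fun b _ => ?_
    rw [h k (Nat.lt_succ_self k), ih (fun i hi => h i (hi.trans (Nat.lt_succ_self k)))]

theorem pathSum_add (T : ℕ → α → α → R) (a : α) (n r : ℕ) (c : α) :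
    pathSum T a (n + r) c
      = ∑ b, pathSum T a n b * pathSum (fun k => T (n + k)) b r c := by
  induction r generalizing c with
  | zero => simp [pathSum]
  | succ r ih =>
    rw [← add_assoc, pathSum]
    simp only [ih, pathSum, Finset.mul_sum, Finset.sum_mul]
    rw [Finset.sum_comm]
    exact Finset.sum_congr rfl fun _ _ => Finset.sum_congr rfl fun _ _ => by ring

theorem pathSum_succ_left (T : ℕ → α → α → R) (a : α) (r : ℕ) (c : α) :
    pathSum T a (r + 1) c = ∑ b, T 0 a b * pathSum (fun k => T (k + 1)) b r c := by
  rw [add_comm r 1, pathSum_add]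
  simp [pathSum, add_comm]

theorem pathSum_reverse (e : α ≃ α) {T T' : ℕ → α → α → R} (a c : α) {r : ℕ}
    (h : ∀ k, k < r → ∀ b d, T' k (e d) (e b) = T (r - 1 - k) b d) :
    pathSum T a r c = pathSum T' (e c) r (e a) := by
  induction r generalizing T a with
  | zero => simp [pathSum, eq_comm]
  | succ r ih =>
    rw [pathSum_succ_left, pathSum,
      ← e.sum_comp fun b => pathSum T' (e c) r b * T' r b (e a)]
    refine Finset.sum_congr rfl fun b _ => ?_
    rw [h r (Nat.lt_succ_self r), ih (T := fun k => T (k + 1))]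
    · rw [show r + 1 - 1 - r = 0 by omega, mul_comm]
    · intro k hk b d
      rw [h k (by omega)]
      congr 1
      omega

theorem sum_paths_eq_pathSum (T : ℕ → α → α → R) (a : α) (k : ℕ) (φ : α → R) :
    ∑ P : Fin (k + 1) → α, (if P 0 = a then 1 else 0)
        * (∏ i : Fin k, T i (P i.castSucc) (P i.succ)) * φ (P (Fin.last k))
      = ∑ c, pathSum T a k c * φ c := by
  induction k generalizing φ with
  | zero =>
    rw [← (Equiv.funUnique (Fin 1) α).symm.sum_comp]
    simp [pathSum]
  | succ k ih =>
    rw [← (Fin.snocEquiv fun _ : Fin (k + 2) => α).sum_comp, Fintype.sum_prod_type_right]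
    have := ih fun b => ∑ c, T k b c * φ c
    simp only [pathSum, Finset.sum_mul]
    simp only [Finset.mul_sum, ← mul_assoc] at this
    refine Eq.trans ?_ (this.trans Finset.sum_comm)
    refine Finset.sum_congr rfl fun P _ => Finset.sum_congr rfl fun c _ => ?_
    rw [Fin.prod_univ_castSucc]
    have h0 : Fin.snocEquiv (fun _ : Fin (k + 2) => α) (c, P) 0 = P 0 :=
      Fin.snoc_castSucc (α := fun _ => α) (x := c) (p := P) (i := 0)
    have h1 : ∀ i : Fin (k + 1), Fin.snocEquiv (fun _ : Fin (k + 2) => α) (c, P) i.castSucc = P i :=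
      fun i => Fin.snoc_castSucc (α := fun _ => α) (x := c) (p := P) (i := i)
    have h2 : Fin.snocEquiv (fun _ : Fin (k + 2) => α) (c, P) (Fin.last (k + 1)) = c :=
      Fin.snoc_last (α := fun _ => α) _ _
    simp only [h0, h1, h2, Fin.succ_castSucc, Fin.succ_last, Fin.val_castSucc, Fin.val_last]
    ring

theorem sum_paths_through (T : ℕ → α → α → R) (a b c : α) {n m : ℕ} (hnm : n < m) :
    ∑ P : Fin (m + 1) → α, (if P 0 = a ∧ P (Fin.castLE (by omega) (Fin.last n)) = b
        ∧ P (Fin.last m) = c then ∏ i : Fin m, T i (P i.castSucc) (P i.succ) else 0)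
      = pathSum T a n b * pathSum (fun k => T (n + k)) b (m - n) c := by
  -- Passage through `b` at time `n` is enforced by killing the steps at time `n` that leave any
  -- other point; `n < m` ensures that such a step exists.
  let T' : ℕ → α → α → R := fun k d e => if k = n ∧ d ≠ b then 0 else T k d e
  have h := sum_paths_eq_pathSum T' a m fun d => if d = c then 1 else 0
  have h1 : ∀ P : Fin (m + 1) → α, (if P 0 = a then 1 else 0)
        * (∏ i : Fin m, T' i (P i.castSucc) (P i.succ)) * (if P (Fin.last m) = c then 1 else 0)
      = if P 0 = a ∧ P (Fin.castLE (by omega) (Fin.last n)) = b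
        ∧ P (Fin.last m) = c then ∏ i : Fin m, T i (P i.castSucc) (P i.succ) else 0 := by
    intro P
    have hidx : Fin.castLE (by omega) (Fin.last n) = (⟨n, hnm⟩ : Fin m).castSucc := by
      ext; simp
    by_cases hb : P (Fin.castLE (by omega) (Fin.last n)) = b
    · have hT : ∀ i : Fin m, T' i (P i.castSucc) (P i.succ) = T i (P i.castSucc) (P i.succ) := by
        intro i
        refine if_neg ?_
        rintro ⟨h1, h2⟩
        apply h2
        rw [← hb, hidx]
        congr 2
        exact Fin.ext h1
      simp only [hT, hb, true_and]
      split_ifs <;> simp_all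
    · have hT : ∏ i : Fin m, T' i (P i.castSucc) (P i.succ) = 0 := by
        refine Finset.prod_eq_zero (Finset.mem_univ ⟨n, hnm⟩) (if_pos ⟨rfl, ?_⟩)
        rw [← hidx]
        exact hb
      rw [hT]
      simp [hb]
  rw [← Finset.sum_congr rfl fun P _ => h1 P, h]
  simp only [mul_ite, mul_one, mul_zero, Finset.sum_ite_eq', Finset.mem_univ, if_true]
  obtain ⟨r, rfl⟩ : ∃ r, m = n + (r + 1) := ⟨m - n - 1, by omega⟩
  rw [pathSum_add, Finset.sum_eq_single b]
  · rw [show n + (r + 1) - n = r + 1 by omega]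
    congr 1
    · refine pathSum_congr (fun i hi d e => ?_) b
      simp [T', hi.ne]
    · refine pathSum_congr (fun i hi d e => ?_) c
      rcases Nat.eq_zero_or_pos i with rfl | hi'
      · by_cases hd : d = b <;> simp [T', pathSum, hd]
      · simp [T', hi'.ne']
  · intro d _ hd
    rw [pathSum_succ_left]
    simp [T', hd]
  · simp

end PathSum

/-! ### Alternating sign matrices as chains of column states -/

section AlternatingSign

variable {m : ℕ}

/-- The sum of the first `p` entries of a sequence. -/
def prefixSum (v : Fin m → ℤ) (p : ℕ) : ℤ :=
  ∑ i ∈ Finset.univ.filter fun i : Fin m => (i : ℕ) < p, v i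

theorem prefixSum_zero (v : Fin m → ℤ) : prefixSum v 0 = 0 := by simp [prefixSum]

theorem prefixSum_succ (v : Fin m → ℤ) (q : Fin m) :
    prefixSum v (q + 1) = prefixSum v q + v q := by
  have : (Finset.univ.filter fun i : Fin m => (i : ℕ) < q + 1)
      = insert q (Finset.univ.filter fun i : Fin m => (i : ℕ) < q) := by
    ext i
    simp only [Finset.mem_filter, Finset.mem_univ, true_and, Finset.mem_insert, Fin.ext_iff]
    omega
  rw [prefixSum, this, Finset.sum_insert (by simp), add_comm]
  rfl

theorem prefixSum_of_le (v : Fin m → ℤ) {p : ℕ} (h : m ≤ p) : prefixSum v p = ∑ i, v i := by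
  rw [prefixSum, Finset.filter_true_of_mem fun i _ => i.isLt.trans_le h]

theorem prefixSum_add_sum_Ici (v : Fin m → ℤ) (q : Fin m) :
    prefixSum v q + ∑ p ∈ Finset.Ici q, v p = ∑ p, v p := by
  have : Finset.Ici q = Finset.univ.filter fun i : Fin m => ¬ (i : ℕ) < q := by
    ext i
    simp only [Finset.mem_Ici, Finset.mem_filter, Finset.mem_univ, true_and, not_lt]
    exact Fin.le_def
  rw [this]
  exact Finset.sum_filter_add_sum_filter_not _ _ _

theorem prefixSum_eq_of_zero (v : Fin m → ℤ) {a b : ℕ} (hab : a ≤ b)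
    (h : ∀ i : Fin m, a ≤ i → (i : ℕ) < b → v i = 0) : prefixSum v b = prefixSum v a := by
  symm
  refine Finset.sum_subset (fun i hi => ?_) fun i hi hi' => ?_
  · simp at hi ⊢; omega
  · simp at hi hi'; exact h i hi' hi

theorem prefixSum_castLE {n : ℕ} (hnm : n ≤ m) (v : Fin m → ℤ) {p : ℕ} (hp : p ≤ n) :
    prefixSum (fun i : Fin n => v (Fin.castLE hnm i)) p = prefixSum v p := by
  induction p with
  | zero => simp [prefixSum_zero]
  | succ p ih =>
    have h1 := prefixSum_succ (fun i : Fin n => v (Fin.castLE hnm i)) ⟨p, hp⟩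
    have h2 := prefixSum_succ v (Fin.castLE hnm ⟨p, hp⟩)
    simp only [Fin.val_castLE] at h1 h2
    rw [h1, h2, ih (by omega)]

/-- All partial sums lie in `{0, 1}` and the total is `1`. -/
def HasUnitPartialSums (v : Fin m → ℤ) : Prop :=
  (∀ p, prefixSum v p = 0 ∨ prefixSum v p = 1) ∧ ∑ i, v i = 1

theorem IsAlternatingSignSeq.hasUnitPartialSums {v : Fin m → ℤ} (hv : IsAlternatingSignSeq v) :
    HasUnitPartialSums v := by
  -- The invariant also records the sign of the last nonzero entry so far: `-1` or none when the
  -- prefix sum is 0, and `1` when it is 1.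
  have key : ∀ p, p ≤ m →
      (prefixSum v p = 0 ∧ ∀ i : Fin m, (i : ℕ) < p → v i ≠ 0 →
        (∀ j : Fin m, i < j → (j : ℕ) < p → v j = 0) → v i = -1) ∨
      (prefixSum v p = 1 ∧ ∃ i : Fin m, (i : ℕ) < p ∧ v i = 1 ∧
        ∀ j : Fin m, i < j → (j : ℕ) < p → v j = 0) := by
    intro p
    induction p with
    | zero => exact fun _ => Or.inl ⟨prefixSum_zero v, fun i hi => absurd hi (Nat.not_lt_zero _)⟩
    | succ p ih =>
      intro hp
      have hstep := prefixSum_succ v ⟨p, hp⟩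
      simp only at hstep
      by_cases h0 : v ⟨p, hp⟩ = 0
      · rw [hstep, h0, add_zero]
        refine (ih (by omega)).imp (fun h => ⟨h.1, fun i hi hne hz => ?_⟩) fun h => ⟨h.1, ?_⟩
        · refine h.2 i ?_ hne fun j hj hjp => hz j hj (by omega)
          rcases Nat.lt_succ_iff_lt_or_eq.mp hi with h' | h'
          · exact h'
          · exact absurd (by rw [← h0]; congr 1; exact Fin.ext h') hne
        · obtain ⟨i, hi, hi1, hz⟩ := h.2
          refine ⟨i, by omega, hi1, fun j hj hjp => ?_⟩
          rcases Nat.lt_succ_iff_lt_or_eq.mp hjp with h' | h'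
          · exact hz j hj h'
          · rw [← h0]; congr 1; exact Fin.ext h'
      · rcases ih (by omega) with ⟨hs, hl⟩ | ⟨hs, i, hi, hi1, hz⟩
        · right
          have h1 : v ⟨p, hp⟩ = 1 := by
            by_cases hall : ∀ j : Fin m, (j : ℕ) < p → v j = 0
            · exact hv.first _ h0 fun j hj => hall j hj
            · push Not at hall
              obtain ⟨j, hj, hj0⟩ := hall
              have hne : (Finset.univ.filter fun j : Fin m => (j : ℕ) < p ∧ v j ≠ 0).Nonempty :=
                ⟨j, by simp [hj, hj0]⟩
              obtain ⟨i, hi, hmax⟩ := Finset.exists_max_image _ id hne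
              rw [Finset.mem_filter] at hi
              have hz : ∀ l : Fin m, i < l → (l : ℕ) < p → v l = 0 := by
                intro l hl' hlp
                by_contra hl0
                exact absurd (hmax l (by simp [hlp, hl0])) (not_le.mpr hl')
              have := hl i hi.2.1 hi.2.2 hz
              rw [hv.alternate i ⟨p, hp⟩ hi.2.1 hi.2.2 h0 fun l h1 h2 => hz l h1 h2, this, neg_neg]
          refine ⟨by rw [hstep, hs, h1]; rfl, ⟨p, hp⟩, by simp, h1, fun j hj hjp => ?_⟩
          have : p < (j : ℕ) := hj
          omega
        · left
          have h1 : v ⟨p, hp⟩ = -1 := by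
            rw [hv.alternate i ⟨p, hp⟩ hi (by rw [hi1]; exact one_ne_zero) h0
              fun l h1 h2 => hz l h1 h2, hi1]
          refine ⟨by rw [hstep, hs, h1]; rfl, fun j hj hj0 hjz => ?_⟩
          rcases Nat.lt_succ_iff_lt_or_eq.mp hj with h' | h'
          · exact absurd (hjz ⟨p, hp⟩ h' (by simp)) h0
          · rw [← h1]; congr 1; exact Fin.ext h'
  have htot : ∑ i, v i = 1 := by
    rw [← prefixSum_of_le v le_rfl]
    rcases key m le_rfl with ⟨_, hl⟩ | ⟨hs, _⟩
    · exfalso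
      obtain ⟨j, hj⟩ := hv.exists_ne_zero
      have hne : (Finset.univ.filter fun j : Fin m => v j ≠ 0).Nonempty := ⟨j, by simp [hj]⟩
      obtain ⟨i, hi, hmax⟩ := Finset.exists_max_image _ id hne
      rw [Finset.mem_filter] at hi
      have hz : ∀ l : Fin m, i < l → v l = 0 := by
        intro l hl'
        by_contra hl0
        exact absurd (hmax l (by simp [hl0])) (not_le.mpr hl')
      have h1 := hl i i.isLt hi.2 fun l h _ => hz l h
      have h2 := hv.last i hi.2 hz
      omega
    · exact hs
  refine ⟨fun p => ?_, htot⟩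
  rcases le_or_gt p m with hp | hp
  · exact (key p hp).imp And.left And.left
  · right
    rw [prefixSum_of_le v hp.le, htot]

theorem HasUnitPartialSums.isAlternatingSignSeq {v : Fin m → ℤ} (hv : HasUnitPartialSums v) :
    IsAlternatingSignSeq v := by
  have hq : ∀ q : Fin m, (prefixSum v q = 0 ∨ prefixSum v q = 1) ∧
      (prefixSum v (q + 1) = 0 ∨ prefixSum v (q + 1) = 1) ∧
      prefixSum v (q + 1) = prefixSum v q + v q :=
    fun q => ⟨hv.1 _, hv.1 _, prefixSum_succ v q⟩
  refine ⟨fun q => ?_, ?_, fun i hi hz => ?_, fun i hi hz => ?_, fun i j hij hi hj hz => ?_⟩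
  · have := hq q
    omega
  · by_contra! h
    have := hv.2
    simp [h] at this
  · have h1 := hq i
    have h2 : prefixSum v i = prefixSum v 0 :=
      prefixSum_eq_of_zero v (Nat.zero_le _) fun j _ hj => hz j hj
    rw [prefixSum_zero] at h2
    omega
  · have h1 := hq i
    have h2 : prefixSum v m = prefixSum v (i + 1) :=
      prefixSum_eq_of_zero v i.isLt fun j hj _ => hz j (Fin.lt_def.mpr hj)
    rw [prefixSum_of_le v le_rfl, hv.2] at h2
    omega
  · have h1 := hq i
    have h2 := hq j
    have h3 : prefixSum v j = prefixSum v (i + 1) :=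
      prefixSum_eq_of_zero v hij fun l h h' => hz l (Fin.lt_def.mpr h) (Fin.lt_def.mpr h')
    omega

theorem isAlternatingSignSeq_iff {v : Fin m → ℤ} :
    IsAlternatingSignSeq v ↔ HasUnitPartialSums v :=
  ⟨fun h => h.hasUnitPartialSums, fun h => h.isAlternatingSignSeq⟩

/-- A prefix sum of 0 must still rise to the total 1, so the next nonzero entry is 1; after a prefix
sum of 1 it could only be `-1`. This makes compass letters readable from partial sums. -/
theorem HasUnitPartialSums.exists_next_eq_one_iff {v : Fin m → ℤ} (hv : HasUnitPartialSums v)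
    (q : Fin m) :
    (∃ r, q < r ∧ v r = 1 ∧ ∀ s, q < s → s < r → v s = 0) ↔ prefixSum v (q + 1) = 0 := by
  constructor
  · rintro ⟨r, hqr, hr, hz⟩
    have h1 : prefixSum v r = prefixSum v (q + 1) :=
      prefixSum_eq_of_zero v hqr fun l h h' => hz l (Fin.lt_def.mpr h) (Fin.lt_def.mpr h')
    have h2 := prefixSum_succ v r
    have h3 := hv.1 r
    have h4 := hv.1 (r + 1)
    omega
  · intro h
    have hne : (Finset.univ.filter fun r : Fin m => q < r ∧ v r ≠ 0).Nonempty := by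
      by_contra hempty
      rw [Finset.not_nonempty_iff_eq_empty, Finset.filter_eq_empty_iff] at hempty
      have h2 : prefixSum v m = prefixSum v (q + 1) := by
        refine prefixSum_eq_of_zero v q.isLt fun j hj _ => ?_
        by_contra hj0
        exact hempty (Finset.mem_univ j) ⟨Fin.lt_def.mpr hj, hj0⟩
      rw [prefixSum_of_le v le_rfl, hv.2] at h2
      omega
    obtain ⟨r, hr, hmin⟩ := Finset.exists_min_image _ id hne
    rw [Finset.mem_filter] at hr
    have hz : ∀ s, q < s → s < r → v s = 0 := by
      intro s h1 h2
      by_contra h0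
      exact absurd (hmin s (by simp [h1, h0])) (not_le.mpr h2)
    refine ⟨r, hr.2.1, ?_, hz⟩
    have h1 : prefixSum v r = prefixSum v (q + 1) :=
      prefixSum_eq_of_zero v hr.2.1 fun l h h' => hz l (Fin.lt_def.mpr h) (Fin.lt_def.mpr h')
    have h2 := prefixSum_succ v r
    have h4 := hv.1 (r + 1)
    have := hr.2.2
    omega

theorem isASM_iff {C : Matrix (Fin m) (Fin m) ℤ} :
    IsASM C ↔ (∀ i, HasUnitPartialSums fun q => C i q) ∧
      ∀ q, HasUnitPartialSums fun i => C i q := by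
  simp only [← isAlternatingSignSeq_iff]
  exact ⟨fun h => ⟨h.row, h.col⟩, fun h => ⟨h.1, h.2⟩⟩

/-- The columns whose first `k` entries sum to `1`. -/
def columnState (C : Matrix (Fin m) (Fin m) ℤ) (k : ℕ) : Finset (Fin m) :=
  Finset.univ.filter fun q => prefixSum (fun i => C i q) k = 1

theorem prefixSum_column_eq {C : Matrix (Fin m) (Fin m) ℤ} (hC : IsASM C) (k : ℕ) (q : Fin m) :
    prefixSum (fun i => C i q) k = if q ∈ columnState C k then 1 else 0 := by
  have := ((isASM_iff.mp hC).2 q).1 k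
  simp only [columnState, Finset.mem_filter, Finset.mem_univ, true_and]
  split_ifs with h <;> omega

theorem entry_eq_columnState {C : Matrix (Fin m) (Fin m) ℤ} (hC : IsASM C) (k q : Fin m) :
    C k q = (if q ∈ columnState C (k + 1) then 1 else 0)
      - if q ∈ columnState C k then 1 else 0 := by
  have := prefixSum_succ (fun i => C i q) k
  rw [prefixSum_column_eq hC, prefixSum_column_eq hC] at this
  omega

theorem sum_Ici_indicator_sub (S S' : Finset (Fin m)) (q : Fin m) :
    ∑ p ∈ Finset.Ici q, ((if p ∈ S' then (1 : ℤ) else 0) - if p ∈ S then 1 else 0)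
      = rowSuffix S S' q := by
  have h : ∀ U : Finset (Fin m), (Finset.Ici q).filter (· ∈ U) = U.filter (q ≤ ·) := by
    intro U; ext p; simp [and_comm]
  rw [Finset.sum_sub_distrib, Finset.sum_boole, Finset.sum_boole, h, h]
  rfl

theorem sum_indicator_sub (S S' : Finset (Fin m)) :
    ∑ p, ((if p ∈ S' then (1 : ℤ) else 0) - if p ∈ S then 1 else 0) = S'.card - S.card := by
  rw [Finset.sum_sub_distrib, Finset.sum_boole, Finset.sum_boole]
  simp

theorem prefixSum_row_eq {C : Matrix (Fin m) (Fin m) ℤ} (hC : IsASM C) (k q : Fin m) :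
    prefixSum (fun q => C k q) q
      = 1 - rowSuffix (columnState C k) (columnState C (k + 1)) q := by
  have h := prefixSum_add_sum_Ici (fun q => C k q) q
  have h1 := sum_Ici_indicator_sub (columnState C k) (columnState C (k + 1)) q
  simp only [← entry_eq_columnState hC] at h1
  have : ∑ q, C k q = 1 := ((isASM_iff.mp hC).1 k).2
  omega

theorem isRowStep_columnState {C : Matrix (Fin m) (Fin m) ℤ} (hC : IsASM C) (k : Fin m) :
    IsRowStep (columnState C k) (columnState C (k + 1)) where
  card := by
    have h := sum_indicator_sub (columnState C k) (columnState C (k + 1))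
    simp only [← entry_eq_columnState hC] at h
    have : ∑ q, C k q = 1 := ((isASM_iff.mp hC).1 k).2
    omega
  suffix q := by
    have h1 := prefixSum_row_eq hC k q
    have h2 := ((isASM_iff.mp hC).1 k).1 q
    omega

theorem columnState_zero (C : Matrix (Fin m) (Fin m) ℤ) : columnState C 0 = ∅ := by
  simp [columnState, prefixSum_zero]

theorem columnState_last {C : Matrix (Fin m) (Fin m) ℤ} (hC : IsASM C) :
    columnState C m = Finset.univ := by
  ext q
  simp [columnState, prefixSum_of_le, ((isASM_iff.mp hC).2 q).2]

/-- At a zero entry, the letter E means suffix sum 1, and the letter N means that the column is not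
in the state below the row. -/
theorem compassMatrix_cases {C : Matrix (Fin m) (Fin m) ℤ} (hC : IsASM C) (k q : Fin m) :
    (compassMatrix C k q = .NE ↔ q ∈ rowNE (columnState C k) (columnState C (k + 1))) ∧
    (compassMatrix C k q = .SE ↔ q ∈ rowSE (columnState C k) (columnState C (k + 1))) ∧
    (compassMatrix C k q = .NS ↔ q ∈ columnState C k \ columnState C (k + 1)) := by
  have hR : NearestRightIsOne C k q ↔ prefixSum (fun q => C k q) (q + 1) = 0 :=
    ((isASM_iff.mp hC).1 k).exists_next_eq_one_iff q
  have hB : NearestBelowIsOne C k q ↔ prefixSum (fun i => C i q) (k + 1) = 0 :=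
    ((isASM_iff.mp hC).2 q).exists_next_eq_one_iff k
  rw [prefixSum_succ, prefixSum_row_eq hC] at hR
  rw [prefixSum_column_eq hC] at hB
  have hs := (isRowStep_columnState hC k).suffix q
  have he := entry_eq_columnState hC k q
  simp only [rowNE, rowSE, Finset.mem_filter, Finset.mem_univ, true_and, Finset.mem_sdiff,
    compassMatrix, hR, hB]
  rw [he]
  by_cases h1 : q ∈ columnState C k <;> by_cases h2 : q ∈ columnState C (k + 1) <;>
    rcases hs with h3 | h3 <;> simp [h1, h2, h3]

theorem prod_compass_eq_rowWeight {R : Type*} [CommRing R] (x y : R)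
    {C : Matrix (Fin m) (Fin m) ℤ} (hC : IsASM C) (k : Fin m) :
    x ^ compassCount .NE C k * y ^ compassCount .SE C k * (x + y) ^ compassCount .NS C k
      = rowWeight x y (columnState C k) (columnState C (k + 1)) := by
  have h := compassMatrix_cases hC k
  have h1 : compassCount .NE C k = (rowNE (columnState C k) (columnState C (k + 1))).card := by
    rw [compassCount]
    congr 1
    ext q
    simp only [Finset.mem_filter, Finset.mem_univ, true_and]
    exact (h q).1
  have h2 : compassCount .SE C k = (rowSE (columnState C k) (columnState C (k + 1))).card := by
    rw [compassCount]
    congr 1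
    ext q
    simp only [Finset.mem_filter, Finset.mem_univ, true_and]
    exact (h q).2.1
  have h3 : compassCount .NS C k = (columnState C k \ columnState C (k + 1)).card := by
    rw [compassCount]
    congr 1
    ext q
    simp only [Finset.mem_filter, Finset.mem_univ, true_and]
    exact (h q).2.2
  rw [rowWeight, if_pos (isRowStep_columnState hC k), h1, h2, h3]

/-- The set of columns labelled by the parts of `μ`. -/
def partSet (m : ℕ) {n : ℕ} (μ : Fin n → ℕ) : Finset (Fin m) :=
  Finset.univ.filter fun q => ∃ j, μ j = (q : ℕ) + 1

/-- Within an alternating sign matrix every condition on the top rows is automatic except the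
prescribed column sums, which fix the state after `n` rows. -/
theorem mem_asmWithTop_iff {n : ℕ} (h : n ≤ m) (μ : Fin n → ℕ) {C : Matrix (Fin m) (Fin m) ℤ} :
    C ∈ asmWithTop h μ ↔ IsASM C ∧ columnState C n = partSet m μ := by
  have htot : ∀ q, ∑ i, C.submatrix (Fin.castLE h) id i q = prefixSum (fun i => C i q) n := by
    intro q
    rw [← prefixSum_castLE h (fun i => C i q) le_rfl, prefixSum_of_le _ le_rfl]
    rfl
  constructor
  · rintro ⟨hC, hμ⟩
    refine ⟨hC, ?_⟩
    ext q
    simp only [columnState, partSet, Finset.mem_filter, Finset.mem_univ, true_and]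
    rw [← htot]
    constructor
    · intro h1
      by_contra hno
      rw [hμ.col_sum_not_mem q hno] at h1
      exact zero_ne_one h1
    · exact hμ.col_sum_mem q
  · rintro ⟨hC, hμ⟩
    have hrow := (isASM_iff.mp hC).1
    have hcol := (isASM_iff.mp hC).2
    refine ⟨hC, fun i q => (hC.row _).entries q, fun i p => ?_, fun j q => ?_,
      fun i => (hrow _).2, fun q hq => ?_, fun q hq => ?_⟩
    · have h1 := prefixSum_add_sum_Ici (fun q => C (Fin.castLE h i) q) p
      have h2 := (hrow (Fin.castLE h i)).1 p
      have h3 : ∑ q, C (Fin.castLE h i) q = 1 := (hrow (Fin.castLE h i)).2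
      simp only [Matrix.submatrix_apply, id]
      omega
    · have h1 : ∑ i ∈ Finset.Iic j, C.submatrix (Fin.castLE h) id i q
          = prefixSum (fun i => C i q) (j + 1) := by
        rw [← prefixSum_castLE h (fun i => C i q) j.isLt, prefixSum]
        refine Finset.sum_congr ?_ fun _ _ => rfl
        ext i
        simp only [Finset.mem_Iic, Finset.mem_filter, Finset.mem_univ, true_and, Nat.lt_succ_iff]
        exact Fin.le_def
      rw [h1]
      exact (hcol q).1 _
    · rw [htot, prefixSum_column_eq hC, hμ, if_pos (by simpa [partSet] using hq)]
    · rw [htot, prefixSum_column_eq hC, hμ, if_neg (by simpa [partSet] using hq)]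

/-- The matrix whose column states are given. -/
def ofStates (P : Fin (m + 1) → Finset (Fin m)) : Matrix (Fin m) (Fin m) ℤ :=
  Matrix.of fun k q => (if q ∈ P k.succ then 1 else 0) - if q ∈ P k.castSucc then 1 else 0

theorem prefixSum_column_ofStates {P : Fin (m + 1) → Finset (Fin m)} (h0 : P 0 = ∅) (q : Fin m)
    (k : Fin (m + 1)) :
    prefixSum (fun i => ofStates P i q) k = if q ∈ P k then 1 else 0 := by
  induction k using Fin.induction with
  | zero => simp [h0, prefixSum_zero]
  | succ k ih =>
    have := prefixSum_succ (fun i => ofStates P i q) k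
    rw [Fin.val_castSucc] at ih
    rw [Fin.val_succ, this, ih]
    simp [ofStates]

theorem columnState_ofStates {P : Fin (m + 1) → Finset (Fin m)} (h0 : P 0 = ∅)
    (k : Fin (m + 1)) : columnState (ofStates P) k = P k := by
  ext q
  simp [columnState, prefixSum_column_ofStates h0]

theorem isASM_ofStates {P : Fin (m + 1) → Finset (Fin m)} (h0 : P 0 = ∅)
    (hlast : P (Fin.last m) = Finset.univ)
    (hstep : ∀ k : Fin m, IsRowStep (P k.castSucc) (P k.succ)) : IsASM (ofStates P) := by
  refine isASM_iff.mpr ⟨fun k => ?_, fun q => ?_⟩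
  · have htot : ∑ q, ofStates P k q = 1 := by
      have h1 := sum_indicator_sub (P k.castSucc) (P k.succ)
      have h2 := (hstep k).card
      refine Eq.trans h1 ?_
      omega
    refine ⟨fun p => ?_, htot⟩
    rcases lt_or_ge p m with hp | hp
    · have h1 := prefixSum_add_sum_Ici (fun q => ofStates P k q) ⟨p, hp⟩
      have h2 : ∑ q ∈ Finset.Ici ⟨p, hp⟩, ofStates P k q
        = rowSuffix (P k.castSucc) (P k.succ) ⟨p, hp⟩ := sum_Ici_indicator_sub _ _ _
      have h3 := (hstep k).suffix ⟨p, hp⟩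
      simp only at h1
      omega
    · exact Or.inr (by rw [prefixSum_of_le _ hp, htot])
  · have htot : ∑ i, ofStates P i q = 1 := by
      have := prefixSum_column_ofStates h0 q (Fin.last m)
      rw [Fin.val_last, prefixSum_of_le _ le_rfl] at this
      simpa [hlast] using this
    refine ⟨fun p => ?_, htot⟩
    rcases lt_or_ge p m with hp | hp
    · have := prefixSum_column_ofStates h0 q ⟨p, by omega⟩
      simp only at this
      rw [this]
      split_ifs <;> simp
    · exact Or.inr (by rw [prefixSum_of_le _ hp, htot])

/-- Matrices correspond to chains through the prescribed state, so the sum factors there. The second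
factor reads the bottom rows upwards with complemented states, hence the reversed indices and the
exchange of `x` and `y`. -/
theorem sum_asmWithTop {R : Type*} [CommRing R] (x y : ℕ → R) {n : ℕ} (hnm : n < m)
    (μ : Fin n → ℕ) :
    ∑ C ∈ (asmWithTop_finite hnm.le μ).toFinset,
        ∏ k : Fin m, x k ^ compassCount .NE C k * y k ^ compassCount .SE C k
          * (x k + y k) ^ compassCount .NS C k
      = topWeight x y n (partSet m μ)
        * topWeight (fun i => y (n + (m - n - 1 - i))) (fun i => x (n + (m - n - 1 - i))) (m - n)
          (partSet m μ)ᶜ := by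
  classical
  have hrev : topWeight (fun i => y (n + (m - n - 1 - i))) (fun i => x (n + (m - n - 1 - i)))
        (m - n) (partSet m μ)ᶜ
      = pathSum (fun k => rowWeight (x (n + k)) (y (n + k))) (partSet m μ) (m - n)
        Finset.univ := by
    -- Complementation relabels the states and turns the final full state into the empty starting
    -- state.
    rw [topWeight, pathSum_reverse ⟨compl, compl, compl_compl, compl_compl⟩ (partSet m μ)
      Finset.univ (T' := fun k => rowWeight (y (n + (m - n - 1 - k))) (x (n + (m - n - 1 - k))))]
    · simp
    · intro k hk S S'
      exact rowWeight_compl _ _ _ _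
  rw [hrev, topWeight, ← sum_paths_through (fun k => rowWeight (x k) (y k)) ∅ (partSet m μ)
    Finset.univ hnm, ← Finset.sum_filter,
    ← Finset.sum_filter_of_ne (p := fun P : Fin (m + 1) → Finset (Fin m) =>
      ∀ k : Fin m, IsRowStep (P k.castSucc) (P k.succ))]
  swap
  · intro P _ hne k
    by_contra h
    exact hne (Finset.prod_eq_zero (Finset.mem_univ k) (if_neg h))
  have hmem : ∀ P ∈ ((Finset.univ : Finset (Fin (m + 1) → Finset (Fin m))).filter fun P => P 0 = ∅ ∧
      P (Fin.castLE (by omega) (Fin.last n)) = partSet m μ ∧ P (Fin.last m) = Finset.univ).filter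
      (fun P => ∀ k : Fin m, IsRowStep (P k.castSucc) (P k.succ)),
      P 0 = ∅ ∧ P (Fin.castLE (by omega) (Fin.last n)) = partSet m μ ∧
      P (Fin.last m) = Finset.univ ∧ ∀ k : Fin m, IsRowStep (P k.castSucc) (P k.succ) := by
    intro P hP
    rw [Finset.mem_filter, Finset.mem_filter] at hP
    exact ⟨hP.1.2.1, hP.1.2.2.1, hP.1.2.2.2, hP.2⟩
  refine Finset.sum_bij' (fun C _ => fun k => columnState C k) (fun P _ => ofStates P)
    ?_ ?_ ?_ ?_ ?_
  · intro C hC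
    rw [Set.Finite.mem_toFinset, mem_asmWithTop_iff] at hC
    rw [Finset.mem_filter, Finset.mem_filter]
    refine ⟨⟨Finset.mem_univ _, columnState_zero C, ?_, columnState_last hC.1⟩,
      fun k => isRowStep_columnState hC.1 k⟩
    exact hC.2
  · intro P hP
    obtain ⟨h0, h1, h2, h3⟩ := hmem P hP
    rw [Set.Finite.mem_toFinset, mem_asmWithTop_iff]
    refine ⟨isASM_ofStates h0 h2 h3, ?_⟩
    rw [← h1, ← columnState_ofStates h0]
    rfl
  · intro C hC
    rw [Set.Finite.mem_toFinset, mem_asmWithTop_iff] at hC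
    ext k q
    rw [entry_eq_columnState hC.1]
    rfl
  · intro P hP
    funext k
    exact columnState_ofStates (hmem P hP).1 k
  · intro C hC
    rw [Set.Finite.mem_toFinset, mem_asmWithTop_iff] at hC
    exact Finset.prod_congr rfl fun k _ => prod_compass_eq_rowWeight (x k) (y k) hC.1 k

end AlternatingSign

/-! ### Complementary states and assembly -/

/-- Reversing the variables multiplies both alternants in the bialternant formula by the same sign.
It undoes the upward reading of the bottom rows. -/
theorem schurValue_reverse {R : Type*} [CommRing R] [IsDomain R] {x : ℕ → R} {n : ℕ}
    {lam : YoungDiagram} (hx : Set.InjOn x (Set.Iio n)) (hlam : lam.colLen 0 ≤ n) :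
    schurValue n lam (fun i => x (n - 1 - i)) = schurValue n lam x := by
  have h1 := schurValue_mul_staircaseAlternant (fun i => x (n - 1 - i)) hlam
  have h2 := schurValue_mul_staircaseAlternant x hlam
  rw [staircaseAlternant, alternant_reverse, alternant_reverse, ← h2] at h1
  have hsign : (((Equiv.Perm.sign (Fin.revPerm (n := n)) : ℤˣ) : ℤ) : R) ≠ 0 := by
    rcases Int.units_eq_one_or (Equiv.Perm.sign (Fin.revPerm (n := n))) with h | h <;> simp [h]
  refine mul_right_cancel₀ (mul_ne_zero hsign (staircaseAlternant_ne_zero hx)) ?_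
  rw [staircaseAlternant] at h1 ⊢
  rw [h1]
  ring

/-- The set of the shifted rows of a diagram, as column indices. -/
def shiftedRowSet (m n : ℕ) (lam : YoungDiagram) : Finset (Fin m) :=
  Finset.univ.filter fun q => ∃ i : Fin n, shiftedRows n lam i = q

theorem shiftedRowSet_eq_image {m n : ℕ} {lam : YoungDiagram}
    (h : ∀ i, shiftedRows n lam i < m) :
    shiftedRowSet m n lam
      = Finset.univ.image fun i : Fin n => (⟨shiftedRows n lam i, h i⟩ : Fin m) := by
  ext q
  simp [shiftedRowSet, Fin.ext_iff]

theorem shiftedRows_mk_strictMono {m n : ℕ} {lam : YoungDiagram}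
    (h : ∀ i, shiftedRows n lam i < m) :
    StrictMono fun i : Fin n => (⟨shiftedRows n lam i, h i⟩ : Fin m) :=
  fun _ _ hij => shiftedRows_strictMono n lam hij

theorem card_shiftedRowSet {m n : ℕ} {lam : YoungDiagram} (h : ∀ i, shiftedRows n lam i < m) :
    (shiftedRowSet m n lam).card = n := by
  rw [shiftedRowSet_eq_image h,
    Finset.card_image_of_injective _ (shiftedRows_mk_strictMono h).injective]
  simp

/-- The factorization of the partition function of the rows above a given column state. -/
theorem topWeight_shiftedRowSet {R : Type*} [CommRing R] [IsDomain R] {x : ℕ → R} (y : ℕ → R)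
    {m n : ℕ} {lam : YoungDiagram} (hx : Set.InjOn x (Set.Iio n)) (hlam : lam.colLen 0 ≤ n)
    (h : ∀ i, shiftedRows n lam i < m) :
    topWeight x y n (shiftedRowSet m n lam)
      = (∏ j ∈ Finset.range n, ∏ i ∈ Finset.range j, (x i + y j)) * schurValue n lam x := by
  refine mul_right_cancel₀ (staircaseAlternant_ne_zero hx) ?_
  rw [topWeight_mul_staircaseAlternant x y n (card_shiftedRowSet h), mul_assoc,
    schurValue_mul_staircaseAlternant x hlam, shiftedRowSet_eq_image h,
    setAlternant_image x (shiftedRows_mk_strictMono h)]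

/-- Column labels start at 1 and `δ` ends at 1, so the two offsets cancel and the zero-based columns
are the exponents of the bialternant formula. -/
theorem partSet_addDelta (m n : ℕ) (lam : YoungDiagram) :
    partSet m (addDelta n lam) = shiftedRowSet m n lam := by
  ext q
  simp only [partSet, shiftedRowSet, Finset.mem_filter, Finset.mem_univ, true_and]
  simp only [addDelta, shiftedRows]
  constructor
  · rintro ⟨j, hj⟩
    refine ⟨j.rev, ?_⟩
    rw [Fin.val_rev, show n - 1 - (n - (j + 1)) = (j : ℕ) by omega]
    omega
  · rintro ⟨i, hi⟩
    refine ⟨i.rev, ?_⟩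
    rw [Fin.val_rev, show n - ((i : ℕ) + 1) = n - 1 - i by omega]
    omega

theorem mem_transpose_rectComplement {a b : ℕ} {lam : YoungDiagram} {i j : ℕ} :
    (i, j) ∈ (rectComplement a b lam).transpose
      ↔ j < a ∧ i < b ∧ (a - 1 - j, b - 1 - i) ∉ lam := by
  rw [YoungDiagram.mem_transpose, ← YoungDiagram.mem_cells]
  simp [rectComplement, and_assoc]

theorem shiftedRows_transpose_rectComplement {a b : ℕ} {lam : YoungDiagram}
    (hlam : lam.colLen 0 ≤ a) (i : Fin b) :
    shiftedRows b (rectComplement a b lam).transpose i + lam.colLen i = a + i := by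
  have hcol : lam.colLen i ≤ a := (lam.colLen_anti 0 i (Nat.zero_le _)).trans hlam
  have key : ∀ j, j < (rectComplement a b lam).transpose.rowLen (b - 1 - i)
      ↔ j < a - lam.colLen i := by
    intro j
    rw [← YoungDiagram.mem_iff_lt_rowLen, mem_transpose_rectComplement,
      YoungDiagram.mem_iff_lt_colLen, show b - 1 - (b - 1 - i) = (i : ℕ) by omega]
    omega
  have h1 := key (a - lam.colLen i)
  have h2 := key ((rectComplement a b lam).transpose.rowLen (b - 1 - i))
  simp only [shiftedRows]
  omega

/-- Equality of `λ_j + n - 1 - j` and `n + i - λ'_i` would force `λ_j + λ'_i = i + j + 1`. The sum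
is at least `i + j + 2` if the cell lies in `λ`, and at most `i + j` otherwise. So the two sets are
disjoint, and their sizes add up to `m`. -/
theorem shiftedRowSet_compl {n m : ℕ} (hnm : n ≤ m) {lam : YoungDiagram}
    (hlam : lam.colLen 0 ≤ n) (h : ∀ i, shiftedRows n lam i < m) :
    (shiftedRowSet m n lam)ᶜ
      = shiftedRowSet m (m - n) (rectComplement n (m - n) lam).transpose := by
  have hk : ∀ i, shiftedRows (m - n) (rectComplement n (m - n) lam).transpose i < m := by
    intro i
    have := shiftedRows_transpose_rectComplement hlam i
    omega
  symm
  refine Finset.eq_of_subset_of_card_le (fun q hq => ?_) ?_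
  · rw [Finset.mem_compl]
    intro hq'
    simp only [shiftedRowSet, Finset.mem_filter, Finset.mem_univ, true_and] at hq hq'
    obtain ⟨i, hi⟩ := hq
    obtain ⟨j, hj⟩ := hq'
    have h1 := shiftedRows_transpose_rectComplement hlam i
    have h2 : (i : ℕ) < lam.rowLen (n - 1 - j) ↔ n - 1 - j < lam.colLen i := by
      rw [← YoungDiagram.mem_iff_lt_rowLen, YoungDiagram.mem_iff_lt_colLen]
    simp only [shiftedRows] at hj h1 hi
    omega
  · rw [card_shiftedRowSet hk, Finset.card_compl, card_shiftedRowSet h, Fintype.card_fin]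

theorem prod_triangle_reflect {M : Type*} [CommMonoid M] (f : ℕ → ℕ → M) (r : ℕ) :
    ∏ j ∈ Finset.range r, ∏ i ∈ Finset.range j, f (r - 1 - j) (r - 1 - i)
      = ∏ j ∈ Finset.range r, ∏ i ∈ Finset.range j, f i j := by
  rw [Finset.prod_sigma', Finset.prod_sigma']
  refine Finset.prod_bij' (fun p _ => ⟨r - 1 - p.2, r - 1 - p.1⟩)
    (fun p _ => ⟨r - 1 - p.2, r - 1 - p.1⟩) ?_ ?_ ?_ ?_ ?_
  · rintro ⟨j, i⟩ h; simp at h ⊢; omega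
  · rintro ⟨j, i⟩ h; simp at h ⊢; omega
  · rintro ⟨j, i⟩ h; simp at h ⊢; omega
  · rintro ⟨j, i⟩ h; simp at h ⊢; omega
  · rintro ⟨j, i⟩ h; rfl

theorem sum_asmWithTop_eq_of_injective {R : Type*} [CommRing R] [IsDomain R] {n m : ℕ} (hnm : n < m)
    {lam : YoungDiagram} (hlen : lam.colLen 0 ≤ n) (hpart : ∀ j : Fin n, addDelta n lam j ≤ m)
    {x y : ℕ → R} (hx : Function.Injective x) (hy : Function.Injective y) :
    (∏ j ∈ Finset.range n, ∏ i ∈ Finset.range j, (x i + y j))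
        * schurValue n lam x
        * (∏ j ∈ Finset.Ico n m, ∏ i ∈ Finset.Ico n j, (x i + y j))
        * schurValue (m - n) (rectComplement n (m - n) lam).transpose (fun k => y (n + k))
      = ∑ C ∈ (asmWithTop_finite hnm.le (addDelta n lam)).toFinset,
          ∏ k : Fin m, x k ^ compassCount .NE C k * y k ^ compassCount .SE C k
            * (x k + y k) ^ compassCount .NS C k := by
  have h : ∀ i, shiftedRows n lam i < m := by
    intro i
    have := hpart i.rev
    simp only [addDelta, Fin.val_rev] at this
    rw [show n - ((i : ℕ) + 1) = n - 1 - i by omega] at this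
    simp only [shiftedRows]
    omega
  have hk : ∀ i, shiftedRows (m - n) (rectComplement n (m - n) lam).transpose i < m := by
    intro i
    have := shiftedRows_transpose_rectComplement hlen i
    omega
  have hkcol : (rectComplement n (m - n) lam).transpose.colLen 0 ≤ m - n :=
    YoungDiagram.colLen_le_of_forall fun i j hc => (mem_transpose_rectComplement.mp hc).2.1
  have hinj : Set.InjOn (fun k => y (n + k)) (Set.Iio (m - n)) :=
    fun a _ b _ e => Nat.add_left_cancel (hy e)
  have hinj' : Set.InjOn (fun i => y (n + (m - n - 1 - i))) (Set.Iio (m - n)) := by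
    intro a ha b hb e
    have := hy e
    rw [Set.mem_Iio] at ha hb
    omega
  rw [sum_asmWithTop x y hnm, partSet_addDelta, shiftedRowSet_compl hnm.le hlen h,
    topWeight_shiftedRowSet y hx.injOn hlen h, topWeight_shiftedRowSet _ hinj' hkcol hk,
    schurValue_reverse (x := fun k => y (n + k)) hinj hkcol, mul_assoc (_ * _)]
  congr 2
  rw [Finset.prod_Ico_eq_prod_range]
  refine Eq.trans ?_ (prod_triangle_reflect (fun i j => y (n + j) + x (n + i)) (m - n)).symm
  refine Finset.prod_congr rfl fun j _ => ?_
  rw [Finset.prod_Ico_eq_prod_range, Nat.add_sub_cancel_left]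
  exact Finset.prod_congr rfl fun i _ => add_comm _ _

theorem map_schurValue {R S : Type*} [CommRing R] [CommRing S] (φ : R →+* S) (N : ℕ)
    (lam : YoungDiagram) (x : ℕ → R) :
    φ (schurValue N lam x) = schurValue N lam fun i => φ (x i) := by
  simp only [schurValue, map_sum, map_prod]

theorem mainTheorem8 {R : Type*} [CommRing R] (n m : ℕ) (hnm : n < m) (lam : YoungDiagram)
    (hlen : lam.colLen 0 ≤ n) (hpart : ∀ j : Fin n, addDelta n lam j ≤ m) (x y : ℕ → R) :
    (∏ j ∈ Finset.range n, ∏ i ∈ Finset.range j, (x i + y j))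
        * schurValue n lam x
        * (∏ j ∈ Finset.Ico n m, ∏ i ∈ Finset.Ico n j, (x i + y j))
        * schurValue (m - n) (rectComplement n (m - n) lam).transpose (fun k => y (n + k))
      = ∑ C ∈ (asmWithTop_finite hnm.le (addDelta n lam)).toFinset,
          ∏ k : Fin m, x k ^ compassCount .NE C k * y k ^ compassCount .SE C k
            * (x k + y k) ^ compassCount .NS C k := by
  -- Distinct indeterminates over `ℤ` meet the domain and injectivity requirements; evaluation
  -- transports the identity to `R`.
  have h := sum_asmWithTop_eq_of_injective (R := MvPolynomial (ℕ ⊕ ℕ) ℤ) hnm hlen hpart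
    (x := fun i => MvPolynomial.X (Sum.inl i)) (y := fun i => MvPolynomial.X (Sum.inr i))
    (fun i j e => Sum.inl_injective (MvPolynomial.X_injective e))
    (fun i j e => Sum.inr_injective (MvPolynomial.X_injective e))
  have h' := congrArg (MvPolynomial.eval₂Hom (Int.castRingHom R) (Sum.elim x y)) h
  simpa only [map_mul, map_prod, map_sum, map_add, map_pow, map_schurValue,
    MvPolynomial.eval₂Hom_X', Sum.elim_inl, Sum.elim_inr] using h'
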